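/- For $r>1$ let $\phi_r(s)=|s|^{r-2}s$. Let $2<p<q$, $p'=p/(p-1)$, and consider the positive periodic solutions $w:\mathbb R\to(0,\infty)$ of $$\big(\phi_p(w')\big)'+\phi_q(w)-\phi_p(w)=0\quad\text{on }\mathbb R,$$ that is, the positive periodic functions $w$ such that $w$ and $\phi_p(w')$ are differentiable and the equation holds at every point. Let $V(w)=\frac1q|w|^q-\frac1p|w|^p+\frac1p-\frac1q$ and $E_*=V(0)=\frac1p-\frac1q$. For every such solution the energy $\frac1{p'}|w'|^p+V(w)$ is constant on $\mathbb R$, with a value $E\in[0,E_*)$. For every $E\in(0,E_*)$ there is a positive periodic solution of energy $E$, and all positive periodic solutions of energy $E$ have the same minimal period (least positive period), denoted by $T(E)$. The function $E\mapsto T(E)$ is (strictly) increasing on $(0,E_*)$, and $$\lim_{E\to0_+}T(E)=0,\qquad \lim_{E\to(E_*)_-}T(E)=+\infty.$$ -/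

import Mathlib

open Set Filter Topology

noncomputable section

namespace PLaplace

/-- The function `φ_r(s) = |s|^(r-2) s`. -/
def phi (r s : ℝ) : ℝ := |s| ^ (r - 2) * s

/-- `w : ℝ → ℝ` is a classical solution on the whole line of
`(φ_p(w'))' + φ_q(w) - φ_p(w) = 0`: both `w` and `φ_p(w')` are differentiable everywhere and the
equation holds at every point. (Continuity of `w'` and of `(φ_p(w'))'` then follows.) -/
def IsSolution (p q : ℝ) (w : ℝ → ℝ) : Prop :=
  Differentiable ℝ w ∧ Differentiable ℝ (fun t => phi p (deriv w t)) ∧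
    ∀ t, deriv (fun s => phi p (deriv w s)) t + phi q (w t) - phi p (w t) = 0

/-- A positive periodic solution (possibly constant). -/
def IsPositivePeriodicSolution (p q : ℝ) (w : ℝ → ℝ) : Prop :=
  IsSolution p q w ∧ (∀ t, 0 < w t) ∧ ∃ S, 0 < S ∧ Function.Periodic w S

/-- The potential `V(x) = |x|^q / q - |x|^p / p + 1/p - 1/q`. -/
def potential (p q x : ℝ) : ℝ := |x| ^ q / q - |x| ^ p / p + 1 / p - 1 / q

/-- The energy level `E_* = V(0)` of the homoclinic orbit. -/
def Estar (p q : ℝ) : ℝ := potential p q 0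

/-- `w` has energy `E`: the first integral `|w'|^p / p' + V(w)`, `p' = p / (p - 1)`,
is identically equal to `E`. -/
def HasEnergy (p q : ℝ) (w : ℝ → ℝ) (E : ℝ) : Prop :=
  ∀ t, 1 / Real.conjExponent p * |deriv w t| ^ p + potential p q (w t) = E

/-- `T` is the minimal period of `w`, i.e. the least of its positive periods. -/
def IsMinimalPeriod (w : ℝ → ℝ) (T : ℝ) : Prop :=
  IsLeast {S : ℝ | 0 < S ∧ Function.Periodic w S} T

/-- Sanity check: `E_* = 1/p - 1/q`. -/
theorem Estar_eq {p q : ℝ} (hp : 0 < p) (hq : 0 < q) : Estar p q = 1 / p - 1 / q := by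
  simp [Estar, potential, Real.zero_rpow hp.ne', Real.zero_rpow hq.ne']

end PLaplace

end

namespace PLaplace

variable {p q x E : ℝ} {w : ℝ → ℝ}

/-! Write V for the potential, V' = φ_q - φ_p on (0, ∞), and a < 1 < b for the roots of V = E. A
solution of energy E has speed |w'| = (p'(E - V(w)))^(1/p), so it oscillates between a and b with
period T(E) = 2 ∫_a^b (p'(E - V))^(-1/p) dx (`period`). Substituting V = E t on each side of 1
gives, up to a constant factor, T(E) = E^(1/2 - 1/p) ∫_0^1 (1 - t)^(-1/p) t^(-1/2) ρ(E t) dt, where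
ρ(v) adds up √V/|V'| over the two points at height v (`period_formula`). Since p > 2, the prefactor
increases strictly from 0, so monotonicity of T and its limit at 0 both follow once ρ is
nondecreasing.

A single branch of √V/|V'| need not be monotone. However, adding 2k√V to √V/V' leaves ρ unchanged,
because the corrections cancel between the two branches at equal height. With k = V'''(1)/(6
V''(1)²) the corrected function is monotone on each side of 1; this is Chicone's criterion in the
form V'²/2 - V V'' + k V'³ ≥ 0 (`chicone_inequality`). That k is the only one possible: it cancels
the cubic term of the expansion at 1, whose sign changes there.

Near E_*, E - V ≤ x^p/p makes the integrand at least C/x, whence a logarithmic divergence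
(`le_period`).

At w' = 0 the equation is degenerate, so Cauchy-Lipschitz is not available at turning points.
Instead the time map Θ = ∫ dx/|w'| turns every periodic solution of energy E into a triangular wave
(`timeMap_after_min`), which gives the minimal period; conversely, Θ⁻¹ of a triangular wave is a
solution (`exists_solution`). -/

lemma phi_of_pos (r : ℝ) (hx : 0 < x) : phi r x = x ^ (r - 1) := by
  rw [phi, abs_of_pos hx, show r - 1 = r - 2 + 1 by ring, Real.rpow_add hx, Real.rpow_one]

lemma potential_of_pos (p q : ℝ) (hx : 0 < x) :
    potential p q x = x ^ q / q - x ^ p / p + 1 / p - 1 / q := by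
  rw [potential, abs_of_pos hx]

/-! ### The potential well and its two monotone branches. -/

lemma hasDerivAt_potential (hp : 1 < p) (hq : 1 < q) (x : ℝ) :
    HasDerivAt (potential p q) (phi q x - phi p x) x := by
  have h := ((((hasDerivAt_abs_rpow x hq).div_const q).sub
    ((hasDerivAt_abs_rpow x hp).div_const p)).add_const (1 / p)).sub_const (1 / q)
  have hp0 : p ≠ 0 := by linarith
  have hq0 : q ≠ 0 := by linarith
  refine HasDerivAt.congr_deriv h ?_
  simp only [phi]
  field_simp

lemma continuous_potential (hp : 1 < p) (hq : 1 < q) : Continuous (potential p q) :=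
  continuous_iff_continuousAt.2 fun x => (hasDerivAt_potential hp hq x).continuousAt

/-- The derivative of the potential on the positive half-line. -/
lemma phi_sub_phi (hx : 0 < x) : phi q x - phi p x = x ^ (p - 1) * (x ^ (q - p) - 1) := by
  rw [phi_of_pos _ hx, phi_of_pos _ hx, show q - 1 = p - 1 + (q - p) by ring, Real.rpow_add hx]
  ring

lemma phi_sub_phi_neg (hpq : p < q) (hx : 0 < x) (hx1 : x < 1) : phi q x - phi p x < 0 := by
  rw [phi_sub_phi hx]
  have := Real.rpow_lt_one hx.le hx1 (sub_pos.2 hpq)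
  exact mul_neg_of_pos_of_neg (Real.rpow_pos_of_pos hx _) (by linarith)

lemma phi_sub_phi_pos (hpq : p < q) (hx1 : 1 < x) : 0 < phi q x - phi p x := by
  have hx : 0 < x := by linarith
  rw [phi_sub_phi hx]
  have := Real.one_lt_rpow hx1 (sub_pos.2 hpq)
  exact mul_pos (Real.rpow_pos_of_pos hx _) (by linarith)

lemma phi_sub_phi_ne_zero (hpq : p < q) (hx : 0 < x) (hx1 : x ≠ 1) : phi q x - phi p x ≠ 0 := by
  rcases lt_or_gt_of_ne hx1 with h | h
  · exact (phi_sub_phi_neg hpq hx h).ne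
  · exact (phi_sub_phi_pos hpq h).ne'

lemma potential_strictAntiOn (hp : 2 < p) (hpq : p < q) :
    StrictAntiOn (potential p q) (Icc 0 1) := by
  refine strictAntiOn_of_deriv_neg (convex_Icc 0 1)
    (continuous_potential (by linarith) (by linarith)).continuousOn fun x hx => ?_
  rw [interior_Icc] at hx
  rw [(hasDerivAt_potential (by linarith) (by linarith) x).deriv]
  exact phi_sub_phi_neg hpq hx.1 hx.2

lemma potential_strictMonoOn (hp : 2 < p) (hpq : p < q) :
    StrictMonoOn (potential p q) (Ici 1) := by
  refine strictMonoOn_of_deriv_pos (convex_Ici 1)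
    (continuous_potential (by linarith) (by linarith)).continuousOn fun x hx => ?_
  rw [interior_Ici] at hx
  rw [(hasDerivAt_potential (by linarith) (by linarith) x).deriv]
  exact phi_sub_phi_pos hpq hx

lemma potential_one (p q : ℝ) : potential p q 1 = 0 := by
  simp [potential]

lemma potential_pos (hp : 2 < p) (hpq : p < q) (hx : 0 < x) (hx1 : x ≠ 1) :
    0 < potential p q x := by
  rw [← potential_one p q]
  rcases lt_or_gt_of_ne hx1 with h | h
  · exact potential_strictAntiOn hp hpq ⟨hx.le, h.le⟩ ⟨zero_le_one, le_rfl⟩ h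
  · exact potential_strictMonoOn hp hpq (mem_Ici.2 le_rfl) (mem_Ici.2 h.le) h

lemma potential_nonneg (hp : 2 < p) (hpq : p < q) (hx : 0 < x) : 0 ≤ potential p q x := by
  rcases eq_or_ne x 1 with rfl | h
  · rw [potential_one]
  · exact (potential_pos hp hpq hx h).le

lemma potential_lt_Estar (hp : 2 < p) (hpq : p < q) (hx : 0 < x) (hx1 : x ≤ 1) :
    potential p q x < Estar p q :=
  potential_strictAntiOn hp hpq ⟨le_rfl, zero_le_one⟩ ⟨hx.le, hx1⟩ hx

lemma exists_potential_eq_left (hp : 2 < p) (hpq : p < q) {E : ℝ} (hE : E ∈ Ioo 0 (Estar p q)) :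
    ∃ x ∈ Ioo (0 : ℝ) 1, potential p q x = E := by
  have h := intermediate_value_Ioo' (zero_le_one (α := ℝ))
    (continuous_potential (p := p) (q := q) (by linarith) (by linarith)).continuousOn
  rw [potential_one] at h
  exact h hE

lemma exists_potential_eq_right (hp : 2 < p) (hpq : p < q) {E : ℝ}
    (hE : E ∈ Ioo 0 (Estar p q)) : ∃ x, 1 < x ∧ potential p q x = E := by
  have hp0 : 0 < p := by linarith
  have hq0 : 0 < q := by linarith
  have hd : 0 < q - p := by linarith
  -- The second zero of V - E_*, where r^q/q = r^p/p.
  set r : ℝ := (q / p) ^ (1 / (q - p)) with hr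
  have hr1 : 1 < r := Real.one_lt_rpow ((one_lt_div hp0).2 hpq) (by positivity)
  have hr0 : 0 < r := by linarith
  have hrd : r ^ (q - p) = q / p := by
    rw [hr, ← Real.rpow_mul (by positivity), one_div_mul_cancel hd.ne', Real.rpow_one]
  have hVr : potential p q r = Estar p q := by
    rw [potential_of_pos _ _ hr0, Estar_eq hp0 hq0, show r ^ q = r ^ p * (q / p) by
      rw [← hrd, ← Real.rpow_add hr0]; congr 1; ring]
    field_simp
    ring
  have h := intermediate_value_Ioo hr1.le
    (continuous_potential (p := p) (q := q) (by linarith) (by linarith)).continuousOn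
  rw [potential_one, hVr] at h
  obtain ⟨x, hx, hxE⟩ := h hE
  exact ⟨x, hx.1, hxE⟩

/-- The two positive roots of `V = E` bound the potential well `{V < E}`. -/
lemma potential_lt_iff (hp : 2 < p) (hpq : p < q) {E a b : ℝ} (ha : a ∈ Ioo (0 : ℝ) 1)
    (haE : potential p q a = E) (hb : 1 < b) (hbE : potential p q b = E) (hx : 0 < x) :
    potential p q x < E ↔ x ∈ Ioo a b := by
  rcases le_total x 1 with h | h
  · rw [← haE, (potential_strictAntiOn hp hpq).lt_iff_gt ⟨hx.le, h⟩ ⟨ha.1.le, ha.2.le⟩]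
    exact ⟨fun h' => ⟨h', by linarith⟩, fun h' => h'.1⟩
  · rw [← hbE, (potential_strictMonoOn hp hpq).lt_iff_lt (mem_Ici.2 h) (mem_Ici.2 hb.le)]
    exact ⟨fun h' => ⟨by linarith [ha.2], h'⟩, fun h' => h'.2⟩

lemma potential_eq_iff (hp : 2 < p) (hpq : p < q) {E a b : ℝ} (ha : a ∈ Ioo (0 : ℝ) 1)
    (haE : potential p q a = E) (hb : 1 < b) (hbE : potential p q b = E) (hx : 0 < x) :
    potential p q x = E ↔ x = a ∨ x = b := by
  constructor
  · intro h
    rcases le_total x 1 with h1 | h1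
    · exact Or.inl ((potential_strictAntiOn hp hpq).injOn ⟨hx.le, h1⟩ ⟨ha.1.le, ha.2.le⟩
        (h.trans haE.symm))
    · exact Or.inr ((potential_strictMonoOn hp hpq).injOn (mem_Ici.2 h1) (mem_Ici.2 hb.le)
        (h.trans hbE.symm))
  · rintro (rfl | rfl) <;> assumption

/-! ### Convexity-type estimate for the potential -/

/-- The second derivative of the potential on the positive half-line. -/
noncomputable def potentialDeriv₂ (p q x : ℝ) : ℝ :=
  (q - 1) * x ^ (q - 2) - (p - 1) * x ^ (p - 2)

/-- The third derivative of the potential on the positive half-line. -/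
noncomputable def potentialDeriv₃ (p q x : ℝ) : ℝ :=
  (q - 1) * (q - 2) * x ^ (q - 3) - (p - 1) * (p - 2) * x ^ (p - 3)

/-- The constant `V'''(1) / (6 V''(1)^2)`. -/
noncomputable def chiconeConst (p q : ℝ) : ℝ := (q + p - 3) / (6 * (q - p))

lemma chiconeConst_pos (hp : 2 < p) (hpq : p < q) : 0 < chiconeConst p q :=
  div_pos (by linarith) (by linarith)

lemma hasDerivAt_phi_sub_phi (hx : 0 < x) :
    HasDerivAt (fun x => phi q x - phi p x) (potentialDeriv₂ p q x) x := by
  have h := (Real.hasDerivAt_rpow_const (x := x) (p := q - 1) (Or.inl hx.ne')).sub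
    (Real.hasDerivAt_rpow_const (x := x) (p := p - 1) (Or.inl hx.ne'))
  rw [show q - 1 - 1 = q - 2 by ring, show p - 1 - 1 = p - 2 by ring] at h
  refine h.congr_of_eventuallyEq ?_
  filter_upwards [lt_mem_nhds hx] with y hy
  simp [phi_of_pos _ hy]

lemma hasDerivAt_potentialDeriv₂ (hx : 0 < x) :
    HasDerivAt (potentialDeriv₂ p q) (potentialDeriv₃ p q x) x := by
  have h := ((Real.hasDerivAt_rpow_const (x := x) (p := q - 2) (Or.inl hx.ne')).const_mul
    (q - 1)).sub ((Real.hasDerivAt_rpow_const (x := x) (p := p - 2) (Or.inl hx.ne')).const_mul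
    (p - 1))
  rw [show q - 2 - 1 = q - 3 by ring, show p - 2 - 1 = p - 3 by ring] at h
  refine HasDerivAt.congr_deriv h ?_
  simp only [potentialDeriv₃]
  ring

lemma potentialDeriv₂_eq (hx : 0 < x) :
    potentialDeriv₂ p q x = x ^ (p - 3) * x * ((q - 1) * x ^ (q - p) - (p - 1)) := by
  rw [potentialDeriv₂, show q - 2 = p - 3 + 1 + (q - p) by ring,
    show p - 2 = p - 3 + 1 by ring, Real.rpow_add hx, Real.rpow_add hx, Real.rpow_one]
  ring

lemma potentialDeriv₃_eq (hx : 0 < x) :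
    potentialDeriv₃ p q x =
      x ^ (p - 3) * ((q - 1) * (q - 2) * x ^ (q - p) - (p - 1) * (p - 2)) := by
  rw [potentialDeriv₃, show q - 3 = p - 3 + (q - p) by ring, Real.rpow_add hx]
  ring

lemma rpow_sub_one_eq (hx : 0 < x) : x ^ (p - 1) = x ^ (p - 3) * x ^ 2 := by
  rw [show p - 1 = p - 3 + 2 by ring, Real.rpow_add hx, Real.rpow_two]

/-- Polynomial part of the sign of the derivative of `V'^2 (1/2 + k V') / V'' - V`. -/
lemma chicone_poly_identity (hpq : p < q) (z : ℝ) :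
    chiconeConst p q * (3 * ((q - 1) * z - (p - 1)) ^ 2 -
        (z - 1) * ((q - 1) * (q - 2) * z - (p - 1) * (p - 2))) -
      ((q - 1) * (q - 2) * z - (p - 1) * (p - 2)) / 2 =
    (z - 1) * (((q + p - 3) * (5 * q - p - 3) - 3 * (q - 1) * (q - 2)) / 6 +
      chiconeConst p q * (q - 1) * (2 * q - 1) * (z - 1)) := by
  have hd : q - p ≠ 0 := by linarith
  rw [chiconeConst]
  field_simp
  ring

/-- The factor is affine and increasing in z, and at the excluded endpoint z = (p-1)/(q-1) it equals
(p-1)(2q-p)/6 > 0. -/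
lemma chicone_factor_pos (hp : 2 < p) (hpq : p < q) {z : ℝ} (hz : p - 1 < (q - 1) * z) :
    0 < ((q + p - 3) * (5 * q - p - 3) - 3 * (q - 1) * (q - 2)) / 6 +
      chiconeConst p q * (q - 1) * (2 * q - 1) * (z - 1) := by
  have hd : 0 < q - p := by linarith
  have hk := chiconeConst_pos hp hpq
  have h1 : chiconeConst p q * (2 * q - 1) * (-(q - p)) ≤
      chiconeConst p q * (2 * q - 1) * ((q - 1) * (z - 1)) :=
    mul_le_mul_of_nonneg_left (by linarith) (mul_nonneg hk.le (by linarith))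
  have h2 : chiconeConst p q * (2 * q - 1) * (-(q - p)) = -((q + p - 3) * (2 * q - 1) / 6) := by
    rw [chiconeConst]; field_simp
  nlinarith [mul_pos (sub_pos.2 hp) hd]

/-- In terms of z = x^(q-p) and r = x^(p-3), the expression is r (x^(p-1) k Q - B/2) with r B =
V'''. As k Q ≥ 0 and x^(p-1) ≥ 1, the power may be replaced by 1, which leaves the polynomial of
`chicone_poly_identity`, with the sign of z - 1. -/
lemma chicone_sign_right (hp : 2 < p) (hpq : p < q) (hx : 1 ≤ x) :
    0 ≤ 3 * chiconeConst p q * potentialDeriv₂ p q x ^ 2 -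
      (1 / 2 + chiconeConst p q * (phi q x - phi p x)) * potentialDeriv₃ p q x := by
  have hx0 : 0 < x := by linarith
  have hk := chiconeConst_pos hp hpq
  rw [phi_sub_phi hx0, potentialDeriv₂_eq hx0, potentialDeriv₃_eq hx0, rpow_sub_one_eq hx0]
  have hm : 1 ≤ x ^ (p - 3) * x ^ 2 := by
    rw [← rpow_sub_one_eq hx0]; exact Real.one_le_rpow hx (by linarith)
  have hz : 1 ≤ x ^ (q - p) := Real.one_le_rpow hx (by linarith)
  have hr : 0 < x ^ (p - 3) := Real.rpow_pos_of_pos hx0 _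
  generalize x ^ (q - p) = z at *
  generalize x ^ (p - 3) = r at *
  have hz' : p - 1 < (q - 1) * z := by nlinarith
  have hid := chicone_poly_identity hpq z
  have hpos := mul_nonneg (sub_nonneg.2 hz) (chicone_factor_pos hp hpq hz').le
  rw [← hid] at hpos
  have hB : 0 ≤ (q - 1) * (q - 2) * z - (p - 1) * (p - 2) := by
    nlinarith [mul_lt_mul_of_pos_right hz' (show 0 < q - 2 by linarith)]
  set B := (q - 1) * (q - 2) * z - (p - 1) * (p - 2)
  set Q := 3 * ((q - 1) * z - (p - 1)) ^ 2 - (z - 1) * B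
  have hkQ : 0 ≤ chiconeConst p q * Q := by linarith
  have : 0 ≤ r * (r * x ^ 2 * (chiconeConst p q * Q) - B / 2) :=
    mul_nonneg hr.le (by nlinarith)
  refine this.trans_eq ?_
  simp only [Q]
  ring

/-- The same reduction with all inequalities reversed: now x^(p-1) ≤ 1 and z ≤ 1. Positivity of V''
supplies the range of z in which the affine factor is positive. -/
lemma chicone_sign_left (hp : 2 < p) (hpq : p < q) (hx0 : 0 < x) (hx : x ≤ 1)
    (h2 : 0 < potentialDeriv₂ p q x) :
    3 * chiconeConst p q * potentialDeriv₂ p q x ^ 2 -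
      (1 / 2 + chiconeConst p q * (phi q x - phi p x)) * potentialDeriv₃ p q x ≤ 0 := by
  have hk := chiconeConst_pos hp hpq
  rw [potentialDeriv₂_eq hx0] at h2
  rw [phi_sub_phi hx0, potentialDeriv₂_eq hx0, potentialDeriv₃_eq hx0, rpow_sub_one_eq hx0]
  have hm : x ^ (p - 3) * x ^ 2 ≤ 1 := by
    rw [← rpow_sub_one_eq hx0]; exact Real.rpow_le_one hx0.le hx (by linarith)
  have hz : x ^ (q - p) ≤ 1 := Real.rpow_le_one hx0.le hx (by linarith)
  have hr : 0 < x ^ (p - 3) := Real.rpow_pos_of_pos hx0 _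
  have hz' : p - 1 < (q - 1) * x ^ (q - p) := by
    have := (mul_pos_iff_of_pos_left (mul_pos hr hx0)).1 h2
    linarith
  generalize x ^ (q - p) = z at *
  generalize x ^ (p - 3) = r at *
  have hid := chicone_poly_identity hpq z
  have hneg := mul_nonpos_of_nonpos_of_nonneg (sub_nonpos.2 hz) (chicone_factor_pos hp hpq hz').le
  rw [← hid] at hneg
  have hB : 0 ≤ (q - 1) * (q - 2) * z - (p - 1) * (p - 2) := by
    nlinarith [mul_lt_mul_of_pos_right hz' (show 0 < q - 2 by linarith)]
  set B := (q - 1) * (q - 2) * z - (p - 1) * (p - 2)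
  have hQ : 0 ≤ 3 * ((q - 1) * z - (p - 1)) ^ 2 - (z - 1) * B := by nlinarith
  set Q := 3 * ((q - 1) * z - (p - 1)) ^ 2 - (z - 1) * B
  have hkQ : 0 ≤ chiconeConst p q * Q := mul_nonneg hk.le hQ
  have : r * (r * x ^ 2 * (chiconeConst p q * Q) - B / 2) ≤ 0 :=
    mul_nonpos_of_nonneg_of_nonpos hr.le (by nlinarith)
  refine le_trans (le_of_eq ?_) this
  simp only [Q]
  ring

/-- Handles the region where V'' ≤ 0. Bernoulli's inequality for u = x^(q-1) and exponent
(p-1)/(q-1) gives V' ≥ -(q-p)/(q-1), and k times this bound is at least -1/2. -/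
lemma half_add_chiconeConst_mul_nonneg (hp : 2 < p) (hpq : p < q) (hx : 0 < x) :
    0 ≤ 1 / 2 + chiconeConst p q * (phi q x - phi p x) := by
  have hd : 0 < q - p := by linarith
  have hq1 : 0 < q - 1 := by linarith
  have hk := chiconeConst_pos hp hpq
  have hu : 0 < x ^ (q - 1) := Real.rpow_pos_of_pos hx _
  have hb := rpow_one_add_le_one_add_mul_self (s := x ^ (q - 1) - 1) (by linarith)
    (p := (p - 1) / (q - 1)) (div_nonneg (by linarith) hq1.le)
    ((div_le_one hq1).2 (by linarith))
  rw [add_sub_cancel, ← Real.rpow_mul hx.le, mul_div_cancel₀ _ hq1.ne'] at hb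
  have hθ : (p - 1) / (q - 1) = 1 - (q - p) / (q - 1) := by field_simp; ring
  rw [hθ] at hb
  have hV : -((q - p) / (q - 1)) ≤ phi q x - phi p x := by
    rw [phi_of_pos _ hx, phi_of_pos _ hx]
    have : 0 < (q - p) / (q - 1) * x ^ (q - 1) := by positivity
    nlinarith
  have h1 := mul_le_mul_of_nonneg_left hV hk.le
  have h2 : chiconeConst p q * ((q - p) / (q - 1)) ≤ 1 / 2 := by
    rw [chiconeConst, div_mul_div_comm, div_le_iff₀ (by positivity)]
    nlinarith
  linarith

lemma hasDerivAt_chicone_quotient (hp : 2 < p) (hpq : p < q) (hx : 0 < x)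
    (h2 : 0 < potentialDeriv₂ p q x) :
    HasDerivAt (fun x => (phi q x - phi p x) ^ 2 *
        (1 / 2 + chiconeConst p q * (phi q x - phi p x)) / potentialDeriv₂ p q x -
        potential p q x)
      ((phi q x - phi p x) ^ 2 / potentialDeriv₂ p q x ^ 2 *
        (3 * chiconeConst p q * potentialDeriv₂ p q x ^ 2 -
      (1 / 2 + chiconeConst p q * (phi q x - phi p x)) * potentialDeriv₃ p q x)) x := by
  have ha := hasDerivAt_phi_sub_phi (p := p) (q := q) hx
  have h := (((ha.fun_pow 2).fun_mul ((ha.const_mul (chiconeConst p q)).const_add (1 / 2))).fun_div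
    (hasDerivAt_potentialDeriv₂ hx) h2.ne').fun_sub
    (hasDerivAt_potential (p := p) (q := q) (by linarith) (by linarith) x)
  refine HasDerivAt.congr_deriv h ?_
  field_simp
  push_cast
  ring

/-- V'' changes sign once, so the quotient by V'' stays defined all the way between x and 1. -/
lemma potentialDeriv₂_pos_of_le (hpq : p < q) (hp : 2 < p) {y : ℝ} (hx : 0 < x)
    (h2 : 0 < potentialDeriv₂ p q x) (hxy : x ≤ y) : 0 < potentialDeriv₂ p q y := by
  have hy : 0 < y := by linarith
  rw [potentialDeriv₂_eq hx] at h2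
  rw [potentialDeriv₂_eq hy]
  have h3 := (mul_pos_iff_of_pos_left (mul_pos (Real.rpow_pos_of_pos hx _) hx)).1 h2
  have h4 : x ^ (q - p) ≤ y ^ (q - p) := Real.rpow_le_rpow hx.le hxy (by linarith)
  refine mul_pos (mul_pos (Real.rpow_pos_of_pos hy _) hy) ?_
  nlinarith

lemma potentialDeriv₂_one_pos (hpq : p < q) : 0 < potentialDeriv₂ p q 1 := by
  simp [potentialDeriv₂]; linarith

/-- A quantitative form of the convexity of `V / V'^2`. -/
lemma chicone_inequality (hp : 2 < p) (hpq : p < q) (hx : 0 < x) :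
    0 ≤ (phi q x - phi p x) ^ 2 / 2 - potential p q x * potentialDeriv₂ p q x +
      chiconeConst p q * (phi q x - phi p x) ^ 3 := by
  -- Where V'' ≤ 0, both V'²(1/2 + kV') and -V V'' are nonnegative. Where V'' > 0, division by V''
  -- leaves a function K with K(1) = 0 that decreases before 1 and increases after it.
  rcases le_or_gt (potentialDeriv₂ p q x) 0 with h2 | h2
  · have h1 := half_add_chiconeConst_mul_nonneg hp hpq hx
    have h3 := mul_nonneg (potential_nonneg hp hpq hx) (neg_nonneg.2 h2)
    nlinarith [mul_nonneg (sq_nonneg (phi q x - phi p x)) h1]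
  set K : ℝ → ℝ := fun x => (phi q x - phi p x) ^ 2 *
        (1 / 2 + chiconeConst p q * (phi q x - phi p x)) / potentialDeriv₂ p q x -
        potential p q x with hK
  have hK1 : K 1 = 0 := by simp [hK, phi, potential_one]
  have hKx : 0 ≤ K x := by
    rcases le_total x 1 with h | h
    · have hder : ∀ y ∈ Icc x 1, HasDerivAt K _ y := fun y hy =>
        hasDerivAt_chicone_quotient hp hpq (hx.trans_le hy.1)
          (potentialDeriv₂_pos_of_le hpq hp hx h2 hy.1)
      have : AntitoneOn K (Icc x 1) := by
        refine antitoneOn_of_deriv_nonpos (convex_Icc _ _)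
          (fun y hy => (hder y hy).continuousAt.continuousWithinAt)
          (fun y hy => (hder y (interior_subset hy)).differentiableAt.differentiableWithinAt)
          fun y hy => ?_
        have hy := interior_subset hy
        rw [(hder y hy).deriv]
        exact mul_nonpos_of_nonneg_of_nonpos (by positivity) (chicone_sign_left hp hpq
          (hx.trans_le hy.1) hy.2 (potentialDeriv₂_pos_of_le hpq hp hx h2 hy.1))
      rw [← hK1]
      exact this ⟨le_rfl, h⟩ ⟨h, le_rfl⟩ h
    · have hder : ∀ y ∈ Icc 1 x, HasDerivAt K _ y := fun y hy =>
        hasDerivAt_chicone_quotient hp hpq (one_pos.trans_le hy.1)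
          (potentialDeriv₂_pos_of_le hpq hp one_pos (potentialDeriv₂_one_pos hpq) hy.1)
      have : MonotoneOn K (Icc 1 x) := by
        refine monotoneOn_of_deriv_nonneg (convex_Icc _ _)
          (fun y hy => (hder y hy).continuousAt.continuousWithinAt)
          (fun y hy => (hder y (interior_subset hy)).differentiableAt.differentiableWithinAt)
          fun y hy => ?_
        have hy := interior_subset hy
        rw [(hder y hy).deriv]
        exact mul_nonneg (by positivity) (chicone_sign_right hp hpq hy.1)
      rw [← hK1]
      exact this ⟨le_rfl, h⟩ ⟨h, le_rfl⟩ h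
  have := mul_nonneg hKx h2.le
  simp only [hK] at this
  rw [sub_mul, div_mul_cancel₀ _ h2.ne'] at this
  nlinarith

/-! ### Monotonicity of the corrected branch function. -/

/-- The function `√V / V' + 2 k √V`, monotone on each side of the bottom of the well. -/
noncomputable def chiconeFun (p q x : ℝ) : ℝ :=
  √(potential p q x) / (phi q x - phi p x) + 2 * chiconeConst p q * √(potential p q x)

lemma hasDerivAt_chiconeFun (hp : 2 < p) (hpq : p < q) (hx : 0 < x) (hx1 : x ≠ 1) :
    HasDerivAt (chiconeFun p q)
      (((phi q x - phi p x) ^ 2 / 2 - potential p q x * potentialDeriv₂ p q x +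
      chiconeConst p q * (phi q x - phi p x) ^ 3) /
        (√(potential p q x) * (phi q x - phi p x) ^ 2)) x := by
  have hV := potential_pos hp hpq hx hx1
  have ha := phi_sub_phi_ne_zero hpq hx hx1
  have hs := (hasDerivAt_potential (p := p) (q := q) (by linarith) (by linarith) x).sqrt hV.ne'
  have h := (hs.fun_div (hasDerivAt_phi_sub_phi (p := p) (q := q) hx) ha).fun_add
    (hs.const_mul (2 * chiconeConst p q))
  refine HasDerivAt.congr_deriv h ?_
  have hsq := Real.sq_sqrt hV.le
  have hs0 := (Real.sqrt_pos.2 hV).ne'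
  set s := √(potential p q x)
  rw [← hsq]
  field_simp

lemma chiconeFun_monotoneOn_of_convex (hp : 2 < p) (hpq : p < q) {s : Set ℝ} (hs : Convex ℝ s)
    (h : ∀ x ∈ s, 0 < x ∧ x ≠ 1) : MonotoneOn (chiconeFun p q) s := by
  have hder := fun x hx => hasDerivAt_chiconeFun hp hpq (h x hx).1 (h x hx).2
  refine monotoneOn_of_deriv_nonneg hs
    (fun y hy => (hder y hy).continuousAt.continuousWithinAt)
    (fun y hy => (hder y (interior_subset hy)).differentiableAt.differentiableWithinAt)
    fun y hy => ?_
  rw [(hder y (interior_subset hy)).deriv]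
  exact div_nonneg (chicone_inequality hp hpq (h y (interior_subset hy)).1) (by positivity)

open MeasureTheory

/-! ### The period integral -/

/-- The reciprocal of the speed `|w'|` at position `x` on the energy level `E`. -/
noncomputable def slowness (p q E x : ℝ) : ℝ :=
  (Real.conjExponent p * (E - potential p q x)) ^ (-(1 / p))

/-- The period of the oscillations of energy `E`. -/
noncomputable def period (p q E : ℝ) : ℝ :=
  2 * ∫ x in {x | 0 < x ∧ potential p q x < E}, slowness p q E x

/-- The turning point of the energy level `E` in `(0, 1)`. -/
noncomputable def leftRoot (p q E : ℝ) : ℝ := Function.invFunOn (potential p q) (Ioo 0 1) E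

/-- The turning point of the energy level `E` in `(1, ∞)`. -/
noncomputable def rightRoot (p q E : ℝ) : ℝ := Function.invFunOn (potential p q) (Ioi 1) E

lemma leftRoot_mem (hp : 2 < p) (hpq : p < q) (hE : E ∈ Ioo 0 (Estar p q)) :
    leftRoot p q E ∈ Ioo (0 : ℝ) 1 :=
  Function.invFunOn_mem (exists_potential_eq_left hp hpq hE)

lemma potential_leftRoot (hp : 2 < p) (hpq : p < q) (hE : E ∈ Ioo 0 (Estar p q)) :
    potential p q (leftRoot p q E) = E :=
  Function.invFunOn_eq (exists_potential_eq_left hp hpq hE)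

lemma one_lt_rightRoot (hp : 2 < p) (hpq : p < q) (hE : E ∈ Ioo 0 (Estar p q)) :
    1 < rightRoot p q E :=
  Function.invFunOn_mem (s := Ioi 1) (exists_potential_eq_right hp hpq hE)

lemma potential_rightRoot (hp : 2 < p) (hpq : p < q) (hE : E ∈ Ioo 0 (Estar p q)) :
    potential p q (rightRoot p q E) = E :=
  Function.invFunOn_eq (s := Ioi 1) (exists_potential_eq_right hp hpq hE)

lemma leftRoot_potential (hp : 2 < p) (hpq : p < q) (hx : x ∈ Ioo (0 : ℝ) 1) :
    leftRoot p q (potential p q x) = x :=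
  ((potential_strictAntiOn hp hpq).injOn.mono Ioo_subset_Icc_self).leftInvOn_invFunOn hx

lemma rightRoot_potential (hp : 2 < p) (hpq : p < q) (hx : 1 < x) :
    rightRoot p q (potential p q x) = x :=
  ((potential_strictMonoOn hp hpq).injOn.mono Ioi_subset_Ici_self).leftInvOn_invFunOn hx

lemma leftRoot_antitoneOn (hp : 2 < p) (hpq : p < q) :
    AntitoneOn (leftRoot p q) (Ioo 0 (Estar p q)) := by
  intro u hu v hv huv
  have hu' := leftRoot_mem hp hpq hu
  have hv' := leftRoot_mem hp hpq hv
  rw [← (potential_strictAntiOn hp hpq).le_iff_ge ⟨hu'.1.le, hu'.2.le⟩ ⟨hv'.1.le, hv'.2.le⟩,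
    potential_leftRoot hp hpq hu, potential_leftRoot hp hpq hv]
  exact huv

lemma rightRoot_monotoneOn (hp : 2 < p) (hpq : p < q) :
    MonotoneOn (rightRoot p q) (Ioo 0 (Estar p q)) := by
  intro u hu v hv huv
  have hu' := one_lt_rightRoot hp hpq hu
  have hv' := one_lt_rightRoot hp hpq hv
  rw [← (potential_strictMonoOn hp hpq).le_iff_le (mem_Ici.2 hu'.le) (mem_Ici.2 hv'.le),
    potential_rightRoot hp hpq hu, potential_rightRoot hp hpq hv]
  exact huv

lemma potential_image_left (hp : 2 < p) (hpq : p < q) (hE : E ∈ Ioo 0 (Estar p q)) :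
    potential p q '' Ioo (leftRoot p q E) 1 = Ioo 0 E := by
  have hm := leftRoot_mem hp hpq hE
  ext v
  constructor
  · rintro ⟨x, hx, rfl⟩
    have hx0 : 0 < x := hm.1.trans hx.1
    exact ⟨potential_pos hp hpq hx0 hx.2.ne, (potential_lt_iff hp hpq hm
      (potential_leftRoot hp hpq hE) (one_lt_rightRoot hp hpq hE)
      (potential_rightRoot hp hpq hE) hx0).2
        ⟨hx.1, hx.2.trans (one_lt_rightRoot hp hpq hE)⟩⟩
  · intro hv
    have h := intermediate_value_Ioo' hm.2.le
      (continuous_potential (p := p) (q := q) (by linarith) (by linarith)).continuousOn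
    rw [potential_one, potential_leftRoot hp hpq hE] at h
    exact h hv

lemma potential_image_right (hp : 2 < p) (hpq : p < q) (hE : E ∈ Ioo 0 (Estar p q)) :
    potential p q '' Ioo 1 (rightRoot p q E) = Ioo 0 E := by
  have hm := one_lt_rightRoot hp hpq hE
  ext v
  constructor
  · rintro ⟨x, hx, rfl⟩
    have hx0 : 0 < x := one_pos.trans hx.1
    exact ⟨potential_pos hp hpq hx0 hx.1.ne', (potential_lt_iff hp hpq (leftRoot_mem hp hpq hE)
      (potential_leftRoot hp hpq hE) hm (potential_rightRoot hp hpq hE) hx0).2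
        ⟨(leftRoot_mem hp hpq hE).2.trans hx.1, hx.2⟩⟩
  · intro hv
    have h := intermediate_value_Ioo hm.le
      (continuous_potential (p := p) (q := q) (by linarith) (by linarith)).continuousOn
    rw [potential_one, potential_rightRoot hp hpq hE] at h
    exact h hv

/-! ### Normalization of the energy in the period integral. -/

/-- The kernel of the period integral after normalization of the energy. -/
noncomputable def periodKernel (p t : ℝ) : ℝ := (1 - t) ^ (-(1 / p)) * t ^ (-(1 / 2) : ℝ)

lemma periodKernel_pos {t : ℝ} (ht : t ∈ Ioo (0 : ℝ) 1) : 0 < periodKernel p t :=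
  mul_pos (Real.rpow_pos_of_pos (by linarith [ht.2]) _) (Real.rpow_pos_of_pos ht.1 _)

/-- The kernel is the integrand of the Beta integral B(1/2, 1 - 1/p). -/
lemma integrableOn_periodKernel (hp : 2 < p) : IntegrableOn (periodKernel p) (Ioo 0 1) := by
  have hp1 : 1 / p < 1 / 2 := one_div_lt_one_div_of_lt two_pos hp
  have h := (Complex.betaIntegral_convergent (u := ((1 / 2 : ℝ) : ℂ))
    (v := ((1 - 1 / p : ℝ) : ℂ)) (by simp) (by rw [Complex.ofReal_re]; linarith)).norm
  rw [intervalIntegrable_iff_integrableOn_Ioo_of_le zero_le_one] at h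
  refine h.congr_fun (fun t ht => ?_) measurableSet_Ioo
  have h1 : 0 < 1 - t := by linarith [ht.2]
  simp only [norm_mul, periodKernel]
  rw [mul_comm, show (1 : ℂ) - t = ((1 - t : ℝ) : ℂ) by push_cast; rfl,
    Complex.norm_cpow_eq_rpow_re_of_pos h1, Complex.norm_cpow_eq_rpow_re_of_pos ht.1]
  congr 2
  · norm_num
  · norm_num

/-- Change of variables `t = V(x) / E` on a branch of the potential well. -/
lemma branch_integral (hp : 2 < p) (hpq : p < q) (hE : 0 < E) {s : Set ℝ}
    (hs : MeasurableSet s) (hs1 : ∀ x ∈ s, 0 < x ∧ x ≠ 1)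
    (himage : potential p q '' s = Ioo 0 E) {W ρ : ℝ → ℝ}
    (hW : ∀ x ∈ s, W (potential p q x) = x)
    (hρ : ∀ v ∈ Ioo 0 E, ρ v = √v / |phi q (W v) - phi p (W v)|)
    (hint : IntegrableOn (fun t => periodKernel p t * ρ (E * t)) (Ioo 0 1)) :
    IntegrableOn (fun x => (E - potential p q x) ^ (-(1 / p))) s ∧
      ∫ x in s, (E - potential p q x) ^ (-(1 / p)) =
        E ^ (1 / 2 - 1 / p) * ∫ t in Ioo (0 : ℝ) 1, periodKernel p t * ρ (E * t) := by
  have hder : ∀ x ∈ s, HasDerivWithinAt (fun x => potential p q x / E)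
      ((phi q x - phi p x) / E) s x := fun x _ =>
    ((hasDerivAt_potential (p := p) (q := q) (by linarith) (by linarith) x).div_const
      E).hasDerivWithinAt
  have hinj : InjOn (fun x => potential p q x / E) s := by
    intro x hx y hy hxy
    have : potential p q x = potential p q y := by
      simpa [div_left_inj' hE.ne'] using hxy
    rw [← hW x hx, ← hW y hy, this]
  have him : (fun x => potential p q x / E) '' s = Ioo 0 1 := by
    rw [← image_image (fun v => v / E) (potential p q), himage]
    ext t
    constructor
    · rintro ⟨v, hv, rfl⟩
      exact ⟨div_pos hv.1 hE, (div_lt_one hE).2 hv.2⟩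
    · intro ht
      exact ⟨E * t, ⟨mul_pos hE ht.1, by nlinarith [ht.2]⟩, by field_simp⟩
  have heq : ∀ x ∈ s, |(phi q x - phi p x) / E| • (E ^ (1 / 2 - 1 / p) *
      (periodKernel p (potential p q x / E) * ρ (E * (potential p q x / E)))) =
        (E - potential p q x) ^ (-(1 / p)) := by
    intro x hx
    have hv : potential p q x ∈ Ioo 0 E := himage ▸ mem_image_of_mem _ hx
    have ha := abs_pos.2 (phi_sub_phi_ne_zero hpq (hs1 x hx).1 (hs1 x hx).2)
    rw [mul_div_cancel₀ _ hE.ne', hρ _ hv, hW x hx, periodKernel, abs_div, abs_of_pos hE,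
      smul_eq_mul, Real.sqrt_eq_rpow,
      show 1 - potential p q x / E = (E - potential p q x) / E by field_simp,
      Real.div_rpow (sub_nonneg.2 hv.2.le) hE.le, Real.div_rpow hv.1.le hE.le,
      Real.rpow_neg hE.le, Real.rpow_neg hE.le, Real.rpow_neg hv.1.le, Real.rpow_sub hE]
    have h1 := Real.rpow_pos_of_pos hE (1 / p)
    have h2 := Real.rpow_pos_of_pos hv.1 (1 / 2)
    have h3 : E ^ (1 / 2 : ℝ) * E ^ (1 / 2 : ℝ) = E := by
      rw [← Real.rpow_add hE]; norm_num
    have h4 := Real.rpow_pos_of_pos hE (1 / 2)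
    generalize (E - potential p q x) ^ (-(1 / p)) = u
    field_simp
    rw [sq, h3]
  constructor
  · have h := (integrableOn_image_iff_integrableOn_abs_deriv_smul hs hder hinj
      (fun t => E ^ (1 / 2 - 1 / p) * (periodKernel p t * ρ (E * t)))).1
      (by rw [him]; exact hint.const_mul _)
    exact h.congr_fun heq hs
  · have h := integral_image_eq_integral_abs_deriv_smul hs hder hinj
      (fun t => E ^ (1 / 2 - 1 / p) * (periodKernel p t * ρ (E * t)))
    rw [him, integral_const_mul] at h
    rw [h]
    exact setIntegral_congr_fun hs fun x hx => (heq x hx).symm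

/-- Monotonicity of A makes the second factor measurable and, because the endpoint E is included,
bounds it above by its value there; nonnegativity bounds it below. So the kernel is multiplied by a
bounded function. -/
lemma integrableOn_periodKernel_mul (hp : 2 < p) (hE : 0 < E) {A : ℝ → ℝ} (c : ℝ)
    (hA : MonotoneOn A (Ioc 0 E)) (h0 : ∀ v ∈ Ioc 0 E, 0 ≤ A v + c * √v) :
    IntegrableOn (fun t => periodKernel p t * (A (E * t) + c * √(E * t))) (Ioo 0 1) := by
  have hmem : ∀ t ∈ Ioo (0 : ℝ) 1, E * t ∈ Ioc 0 E := fun t ht =>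
    ⟨mul_pos hE ht.1, by nlinarith [ht.2]⟩
  refine Integrable.mul_bdd (c := A E + |c| * √E) (integrableOn_periodKernel hp) ?_ ?_
  · refine AEMeasurable.aestronglyMeasurable (AEMeasurable.add ?_ ?_)
    · refine aemeasurable_restrict_of_monotoneOn measurableSet_Ioo fun s hs t ht hst => ?_
      exact hA (hmem s hs) (hmem t ht) (mul_le_mul_of_nonneg_left hst hE.le)
    · fun_prop
  · refine (ae_restrict_iff' measurableSet_Ioo).2 (.of_forall fun t ht => ?_)
    have hm := hmem t ht
    rw [Real.norm_of_nonneg (h0 _ hm)]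
    refine add_le_add (hA hm ⟨hE, le_rfl⟩ hm.2) ?_
    exact mul_le_mul (le_abs_self c) (Real.sqrt_le_sqrt hm.2) (Real.sqrt_nonneg _) (abs_nonneg _)

/-- The sum over the two branches of `√V / |V'|` at height `v`. -/
noncomputable def branchSum (p q v : ℝ) : ℝ :=
  chiconeFun p q (rightRoot p q v) - chiconeFun p q (leftRoot p q v)

lemma chiconeFun_rightRoot_monotoneOn (hp : 2 < p) (hpq : p < q) :
    MonotoneOn (fun v => chiconeFun p q (rightRoot p q v)) (Ioo 0 (Estar p q)) :=
  fun u hu v hv huv => chiconeFun_monotoneOn_of_convex hp hpq (convex_Ioi 1)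
    (fun x (hx : 1 < x) => ⟨by linarith, hx.ne'⟩) (one_lt_rightRoot hp hpq hu)
    (one_lt_rightRoot hp hpq hv) (rightRoot_monotoneOn hp hpq hu hv huv)

lemma neg_chiconeFun_leftRoot_monotoneOn (hp : 2 < p) (hpq : p < q) :
    MonotoneOn (fun v => -chiconeFun p q (leftRoot p q v)) (Ioo 0 (Estar p q)) :=
  fun _ hu _ hv huv => neg_le_neg (chiconeFun_monotoneOn_of_convex hp hpq (convex_Ioo 0 1)
    (fun _ hx => ⟨hx.1, hx.2.ne⟩) (leftRoot_mem hp hpq hv)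
    (leftRoot_mem hp hpq hu) (leftRoot_antitoneOn hp hpq hu hv huv))

/-- As the height grows, the right root moves right and the left root moves left; the minus sign on
the left branch restores the direction. -/
lemma branchSum_monotoneOn (hp : 2 < p) (hpq : p < q) :
    MonotoneOn (branchSum p q) (Ioo 0 (Estar p q)) := by
  intro u hu v hv huv
  have h1 := chiconeFun_rightRoot_monotoneOn hp hpq hu hv huv
  have h2 := neg_chiconeFun_leftRoot_monotoneOn hp hpq hu hv huv
  simp only [branchSum] at *
  linarith

lemma chiconeFun_rightRoot (hp : 2 < p) (hpq : p < q) (hE : E ∈ Ioo 0 (Estar p q)) :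
    chiconeFun p q (rightRoot p q E) + -(2 * chiconeConst p q) * √E =
      √E / |phi q (rightRoot p q E) - phi p (rightRoot p q E)| := by
  rw [chiconeFun, potential_rightRoot hp hpq hE,
    abs_of_pos (phi_sub_phi_pos hpq (one_lt_rightRoot hp hpq hE))]
  ring

lemma neg_chiconeFun_leftRoot (hp : 2 < p) (hpq : p < q) (hE : E ∈ Ioo 0 (Estar p q)) :
    -chiconeFun p q (leftRoot p q E) + 2 * chiconeConst p q * √E =
      √E / |phi q (leftRoot p q E) - phi p (leftRoot p q E)| := by
  have hm := leftRoot_mem hp hpq hE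
  rw [chiconeFun, potential_leftRoot hp hpq hE, abs_of_neg (phi_sub_phi_neg hpq hm.1 hm.2),
    div_neg]
  ring

lemma branchSum_pos (hp : 2 < p) (hpq : p < q) (hE : E ∈ Ioo 0 (Estar p q)) :
    0 < branchSum p q E := by
  have h1 := chiconeFun_rightRoot hp hpq hE
  have h2 := neg_chiconeFun_leftRoot hp hpq hE
  have h3 : 0 < √E / |phi q (rightRoot p q E) - phi p (rightRoot p q E)| :=
    div_pos (Real.sqrt_pos.2 hE.1)
      (abs_pos.2 (phi_sub_phi_pos hpq (one_lt_rightRoot hp hpq hE)).ne')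
  have h4 : 0 ≤ √E / |phi q (leftRoot p q E) - phi p (leftRoot p q E)| := by positivity
  rw [branchSum]
  linarith

lemma well_eq (hp : 2 < p) (hpq : p < q) (hE : E ∈ Ioo 0 (Estar p q)) :
    {x | 0 < x ∧ potential p q x < E} = Ioo (leftRoot p q E) (rightRoot p q E) := by
  have hm := leftRoot_mem hp hpq hE
  ext x
  constructor
  · rintro ⟨hx, h⟩
    exact (potential_lt_iff hp hpq hm (potential_leftRoot hp hpq hE)
      (one_lt_rightRoot hp hpq hE) (potential_rightRoot hp hpq hE) hx).1 h
  · intro h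
    have hx := hm.1.trans h.1
    exact ⟨hx, (potential_lt_iff hp hpq hm (potential_leftRoot hp hpq hE)
      (one_lt_rightRoot hp hpq hE) (potential_rightRoot hp hpq hE) hx).2 h⟩

lemma conjExponent_pos (hp : 2 < p) : 0 < Real.conjExponent p := by
  rw [Real.conjExponent]; exact div_pos (by linarith) (by linarith)

lemma slowness_eq_mul (hp : 2 < p) (hx : potential p q x ≤ E) :
    slowness p q E x =
      Real.conjExponent p ^ (-(1 / p)) * (E - potential p q x) ^ (-(1 / p)) := by
  rw [slowness, Real.mul_rpow (conjExponent_pos hp).le (sub_nonneg.2 hx)]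

lemma slowness_pos (hp : 2 < p) (hx : potential p q x < E) : 0 < slowness p q E x :=
  Real.rpow_pos_of_pos (mul_pos (conjExponent_pos hp) (sub_pos.2 hx)) _

lemma period_formula (hp : 2 < p) (hpq : p < q) (hE : E ∈ Ioo 0 (Estar p q)) :
    IntegrableOn (slowness p q E) (Ioo (leftRoot p q E) (rightRoot p q E)) ∧
    IntegrableOn (fun t => periodKernel p t * branchSum p q (E * t)) (Ioo 0 1) ∧
    period p q E = 2 * Real.conjExponent p ^ (-(1 / p)) * (E ^ (1 / 2 - 1 / p) *
      ∫ t in Ioo (0 : ℝ) 1, periodKernel p t * branchSum p q (E * t)) := by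
  have hl := leftRoot_mem hp hpq hE
  have hr := one_lt_rightRoot hp hpq hE
  have hsub : Ioc 0 E ⊆ Ioo 0 (Estar p q) := fun v hv => ⟨hv.1, hv.2.trans_lt hE.2⟩
  have hIr := integrableOn_periodKernel_mul hp hE.1 (-(2 * chiconeConst p q))
    ((chiconeFun_rightRoot_monotoneOn hp hpq).mono hsub) fun v hv => by
      rw [chiconeFun_rightRoot hp hpq (hsub hv)]; positivity
  have hIl := integrableOn_periodKernel_mul hp hE.1 (2 * chiconeConst p q)
    ((neg_chiconeFun_leftRoot_monotoneOn hp hpq).mono hsub) fun v hv => by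
      rw [neg_chiconeFun_leftRoot hp hpq (hsub hv)]; positivity
  obtain ⟨hr1, hr2⟩ := branch_integral hp hpq hE.1 (s := Ioo 1 (rightRoot p q E)) measurableSet_Ioo
    (fun x hx => ⟨one_pos.trans hx.1, hx.1.ne'⟩) (potential_image_right hp hpq hE)
    (W := rightRoot p q) (ρ := fun v => chiconeFun p q (rightRoot p q v) +
      -(2 * chiconeConst p q) * √v)
    (fun x hx => rightRoot_potential hp hpq hx.1)
    (fun v hv => chiconeFun_rightRoot hp hpq (hsub ⟨hv.1, hv.2.le⟩)) hIr
  obtain ⟨hl1, hl2⟩ := branch_integral hp hpq hE.1 (s := Ioo (leftRoot p q E) 1) measurableSet_Ioo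
    (fun x hx => ⟨hl.1.trans hx.1, hx.2.ne⟩) (potential_image_left hp hpq hE)
    (W := leftRoot p q) (ρ := fun v => -chiconeFun p q (leftRoot p q v) +
      2 * chiconeConst p q * √v)
    (fun x hx => leftRoot_potential hp hpq ⟨hl.1.trans hx.1, hx.2⟩)
    (fun v hv => neg_chiconeFun_leftRoot hp hpq (hsub ⟨hv.1, hv.2.le⟩)) hIl
  -- The point 1, where V' vanishes, is discarded as a null set.
  have hae : Ioo (leftRoot p q E) (rightRoot p q E) =ᵐ[volume]
      (Ioo (leftRoot p q E) 1 ∪ Ioo 1 (rightRoot p q E) : Set ℝ) := by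
    rw [← Ioo_union_Ico_eq_Ioo hl.2 hr.le]
    exact (ae_eq_refl _).union Ioo_ae_eq_Ico.symm
  have hI : IntegrableOn (fun x => (E - potential p q x) ^ (-(1 / p)))
      (Ioo (leftRoot p q E) (rightRoot p q E)) :=
    (hl1.union hr1).congr_set_ae hae
  have hslow : EqOn (fun x => Real.conjExponent p ^ (-(1 / p)) *
      (E - potential p q x) ^ (-(1 / p))) (slowness p q E)
      (Ioo (leftRoot p q E) (rightRoot p q E)) := fun x hx => by
    rw [← well_eq hp hpq hE] at hx
    exact (slowness_eq_mul hp hx.2.le).symm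
  have hsum : ∀ t, periodKernel p t * branchSum p q (E * t) =
      periodKernel p t * (chiconeFun p q (rightRoot p q (E * t)) +
        -(2 * chiconeConst p q) * √(E * t)) +
      periodKernel p t * (-chiconeFun p q (leftRoot p q (E * t)) +
        2 * chiconeConst p q * √(E * t)) := fun t => by rw [branchSum]; ring
  refine ⟨IntegrableOn.congr_fun (hI.const_mul _) hslow measurableSet_Ioo, ?_, ?_⟩
  · simp only [hsum]
    exact hIr.add hIl
  · rw [period, well_eq hp hpq hE, ← setIntegral_congr_fun measurableSet_Ioo hslow,
      integral_const_mul, setIntegral_congr_set hae,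
      setIntegral_union (by
        rw [Set.disjoint_left]; rintro x hx hx'; exact lt_asymm hx.2 hx'.1)
        measurableSet_Ioo hl1 hr1, hl2, hr2]
    simp only [hsum]
    rw [integral_add hIr hIl]
    ring

/-! ### Monotonicity and limits of the period. -/

/-- The period with the energy scaling factored out. -/
noncomputable def scaledPeriod (p q E : ℝ) : ℝ :=
  ∫ t in Ioo (0 : ℝ) 1, periodKernel p t * branchSum p q (E * t)

lemma mul_mem_Ioo_Estar (hE : E ∈ Ioo 0 (Estar p q)) {t : ℝ} (ht : t ∈ Ioo (0 : ℝ) 1) :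
    E * t ∈ Ioo 0 (Estar p q) :=
  ⟨mul_pos hE.1 ht.1, by nlinarith [ht.2, hE.1, hE.2]⟩

lemma scaledPeriod_monotoneOn (hp : 2 < p) (hpq : p < q) :
    MonotoneOn (scaledPeriod p q) (Ioo 0 (Estar p q)) := by
  intro u hu v hv huv
  refine setIntegral_mono_on (period_formula hp hpq hu).2.1 (period_formula hp hpq hv).2.1
    measurableSet_Ioo fun t ht => ?_
  exact mul_le_mul_of_nonneg_left (branchSum_monotoneOn hp hpq (mul_mem_Ioo_Estar hu ht)
    (mul_mem_Ioo_Estar hv ht) (mul_le_mul_of_nonneg_right huv ht.1.le)) (periodKernel_pos ht).le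

lemma scaledPeriod_pos (hp : 2 < p) (hpq : p < q) (hE : E ∈ Ioo 0 (Estar p q)) :
    0 < scaledPeriod p q E := by
  have h := (period_formula hp hpq hE).2.1
  rw [scaledPeriod, ← integral_Ioc_eq_integral_Ioo,
    ← intervalIntegral.integral_of_le zero_le_one]
  refine intervalIntegral.intervalIntegral_pos_of_pos_on
    ((intervalIntegrable_iff_integrableOn_Ioo_of_le zero_le_one).2 h) (fun t ht => ?_) one_pos
  exact mul_pos (periodKernel_pos ht) (branchSum_pos hp hpq (mul_mem_Ioo_Estar hE ht))

lemma period_eq_scaledPeriod (hp : 2 < p) (hpq : p < q) (hE : E ∈ Ioo 0 (Estar p q)) :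
    period p q E = 2 * Real.conjExponent p ^ (-(1 / p)) *
      (E ^ (1 / 2 - 1 / p) * scaledPeriod p q E) :=
  (period_formula hp hpq hE).2.2

lemma half_sub_one_div_pos (hp : 2 < p) : 0 < 1 / 2 - 1 / p :=
  sub_pos.2 (one_div_lt_one_div_of_lt two_pos hp)

theorem period_strictMonoOn (hp : 2 < p) (hpq : p < q) :
    StrictMonoOn (period p q) (Ioo 0 (Estar p q)) := by
  intro u hu v hv huv
  rw [period_eq_scaledPeriod hp hpq hu, period_eq_scaledPeriod hp hpq hv]
  have hc := Real.rpow_pos_of_pos (conjExponent_pos hp) (-(1 / p))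
  refine mul_lt_mul_of_pos_left ?_ (by positivity)
  calc u ^ (1 / 2 - 1 / p) * scaledPeriod p q u
      < v ^ (1 / 2 - 1 / p) * scaledPeriod p q u :=
        mul_lt_mul_of_pos_right (Real.rpow_lt_rpow hu.1.le huv (half_sub_one_div_pos hp))
          (scaledPeriod_pos hp hpq hu)
    _ ≤ v ^ (1 / 2 - 1 / p) * scaledPeriod p q v :=
        mul_le_mul_of_nonneg_left (scaledPeriod_monotoneOn hp hpq hu hv huv.le)
          (Real.rpow_nonneg hv.1.le _)

lemma Estar_pos (hp : 2 < p) (hpq : p < q) : 0 < Estar p q := by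
  rw [Estar_eq (by linarith) (by linarith)]
  exact sub_pos.2 (one_div_lt_one_div_of_lt (by linarith) hpq)

/-- For E < E_*/2 the integral factor is at most its value at E_*/2, while E^(1/2 - 1/p) tends to 0.
-/
theorem tendsto_period_zero (hp : 2 < p) (hpq : p < q) :
    Tendsto (period p q) (𝓝[>] 0) (𝓝 0) := by
  have hEs := Estar_pos hp hpq
  have hmem : Estar p q / 2 ∈ Ioo 0 (Estar p q) := ⟨by linarith, by linarith⟩
  have hc := Real.rpow_pos_of_pos (conjExponent_pos hp) (-(1 / p))
  have hα := half_sub_one_div_pos hp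
  have hlim : Tendsto (fun E : ℝ => 2 * Real.conjExponent p ^ (-(1 / p)) *
      (E ^ (1 / 2 - 1 / p) * scaledPeriod p q (Estar p q / 2))) (𝓝[>] 0) (𝓝 0) := by
    have h : ContinuousAt (fun E : ℝ => 2 * Real.conjExponent p ^ (-(1 / p)) *
        (E ^ (1 / 2 - 1 / p) * scaledPeriod p q (Estar p q / 2))) 0 :=
      continuousAt_const.mul ((Real.continuousAt_rpow_const _ _ (Or.inr hα.le)).mul
        continuousAt_const)
    have h' := h.tendsto.mono_left (nhdsWithin_le_nhds (s := Ioi 0))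
    rwa [Real.zero_rpow hα.ne', zero_mul, mul_zero] at h'
  have hev : ∀ᶠ E in 𝓝[>] 0, E ∈ Ioo 0 (Estar p q / 2) := Ioo_mem_nhdsGT hmem.1
  refine squeeze_zero' ?_ ?_ hlim
  · filter_upwards [hev] with E hE
    have hE' : E ∈ Ioo 0 (Estar p q) := ⟨hE.1, hE.2.trans hmem.2⟩
    rw [period_eq_scaledPeriod hp hpq hE']
    have := scaledPeriod_pos hp hpq hE'
    have := Real.rpow_pos_of_pos hE.1 (1 / 2 - 1 / p)
    positivity
  · filter_upwards [hev] with E hE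
    have hE' : E ∈ Ioo 0 (Estar p q) := ⟨hE.1, hE.2.trans hmem.2⟩
    rw [period_eq_scaledPeriod hp hpq hE']
    have := scaledPeriod_monotoneOn hp hpq hE' hmem hE.2.le
    have := Real.rpow_pos_of_pos hE.1 (1 / 2 - 1 / p)
    gcongr

/-- Below E_* one has E - V(x) < x^p/p - x^q/q < x^p/p. -/
lemma le_slowness (hp : 2 < p) (hpq : p < q) (hE : E < Estar p q) (hx : 0 < x)
    (hxE : potential p q x < E) :
    (Real.conjExponent p / p) ^ (-(1 / p)) * x⁻¹ ≤ slowness p q E x := by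
  have hp0 : 0 < p := by linarith
  have hc := conjExponent_pos hp
  have h1 : (Real.conjExponent p / p) ^ (-(1 / p)) * x⁻¹ =
      (Real.conjExponent p * (x ^ p / p)) ^ (-(1 / p)) := by
    rw [show Real.conjExponent p * (x ^ p / p) = Real.conjExponent p / p * x ^ p by ring,
      Real.mul_rpow (by positivity) (by positivity), ← Real.rpow_mul hx.le,
      show p * -(1 / p) = -1 by field_simp, Real.rpow_neg_one]
  rw [h1, slowness]
  refine Real.rpow_le_rpow_of_nonpos (mul_pos hc (sub_pos.2 hxE)) ?_
    (neg_nonpos.2 (by positivity))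
  refine mul_le_mul_of_nonneg_left ?_ hc.le
  rw [Estar_eq hp0 (by linarith)] at hE
  rw [potential_of_pos _ _ hx]
  have : 0 < x ^ q / q := div_pos (Real.rpow_pos_of_pos hx _) (by linarith)
  linarith

lemma le_period (hp : 2 < p) (hpq : p < q) (hE : E < Estar p q) {ε : ℝ} (hε : 0 < ε)
    (hε1 : ε < 1) (hεE : potential p q ε < E) :
    2 * ((Real.conjExponent p / p) ^ (-(1 / p)) * -Real.log ε) ≤ period p q E := by
  have hE' : E ∈ Ioo 0 (Estar p q) := ⟨(potential_pos hp hpq hε hε1.ne).trans hεE, hE⟩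
  have hI := (period_formula hp hpq hE').1
  rw [← well_eq hp hpq hE'] at hI
  have hsub : Ioo ε 1 ⊆ {x | 0 < x ∧ potential p q x < E} := fun x hx =>
    ⟨hε.trans hx.1, (potential_strictAntiOn hp hpq ⟨hε.le, hε1.le⟩
      ⟨(hε.trans hx.1).le, hx.2.le⟩ hx.1).trans hεE⟩
  have hlog : ∫ x in Ioo ε 1, x⁻¹ = -Real.log ε := by
    rw [← integral_Ioc_eq_integral_Ioo, ← intervalIntegral.integral_of_le hε1.le,
      integral_inv_of_pos hε one_pos, one_div, Real.log_inv]
  have hinv : IntegrableOn (fun x : ℝ => x⁻¹) (Ioo ε 1) := by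
    rw [← intervalIntegrable_iff_integrableOn_Ioo_of_le hε1.le]
    refine intervalIntegral.intervalIntegrable_inv (fun x hx => ?_) continuousOn_id
    rw [uIcc_of_le hε1.le] at hx
    exact (hε.trans_le hx.1).ne'
  rw [period, ← hlog, ← integral_const_mul]
  refine mul_le_mul_of_nonneg_left ?_ two_pos.le
  calc _ ≤ ∫ x in Ioo ε 1, slowness p q E x :=
        setIntegral_mono_on (hinv.const_mul _) (hI.mono_set hsub) measurableSet_Ioo
          fun x hx => le_slowness hp hpq hE (hsub hx).1 (hsub hx).2
    _ ≤ _ := setIntegral_mono_set hI ((ae_restrict_iff' (by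
          rw [well_eq hp hpq hE']; exact measurableSet_Ioo)).2
          (.of_forall fun x hx => (slowness_pos hp hx.2).le)) hsub.eventuallyLE

theorem tendsto_period_atTop (hp : 2 < p) (hpq : p < q) :
    Tendsto (period p q) (𝓝[<] (Estar p q)) atTop := by
  refine tendsto_atTop.2 fun M => ?_
  have hC := Real.rpow_pos_of_pos (div_pos (conjExponent_pos hp) (show 0 < p by linarith))
    (-(1 / p))
  set C := (Real.conjExponent p / p) ^ (-(1 / p))
  -- Chosen so that the lower bound of `le_period` equals |M| + 1.
  set ε := Real.exp (-((|M| + 1) / (2 * C))) with hεdef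
  have hε : 0 < ε := Real.exp_pos _
  have hε1 : ε < 1 := Real.exp_lt_one_iff.2 (neg_lt_zero.2 (by positivity))
  have hev : ∀ᶠ E in 𝓝[<] (Estar p q), E ∈ Ioo (potential p q ε) (Estar p q) :=
    Ioo_mem_nhdsLT (potential_lt_Estar hp hpq hε hε1.le)
  filter_upwards [hev] with E hE
  refine le_trans ?_ (le_period hp hpq hE.2 hε hε1 hE.1)
  rw [hεdef, Real.log_exp, neg_neg,
    show 2 * (C * ((|M| + 1) / (2 * C))) = |M| + 1 by field_simp]
  linarith [le_abs_self M]

/-! ### The time map -/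

/-- A positive integrable density on `(a, b)`, continuous there, has a primitive that extends to an
increasing bijection of the line. -/
lemma exists_orderIso_primitive {a b : ℝ} (hab : a < b) {h₀ : ℝ → ℝ}
    (hint : IntegrableOn h₀ (Ioo a b)) (hpos : ∀ x ∈ Ioo a b, 0 < h₀ x)
    (hcont : ContinuousOn h₀ (Ioo a b)) :
    ∃ Θ : ℝ ≃o ℝ, Θ a = 0 ∧ Θ b = ∫ x in Ioo a b, h₀ x ∧
      ∀ x ∈ Ioo a b, HasDerivAt Θ (h₀ x) x := by
  -- Density 1 outside (a, b) makes the primitive affine near ±∞, hence onto.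
  set h : ℝ → ℝ := fun x => (Ioo a b).indicator h₀ x + (Ioo a b)ᶜ.indicator (fun _ => 1) x with hh
  have hin : ∀ x ∈ Ioo a b, h x = h₀ x := fun x hx => by simp [hh, hx]
  have hout : ∀ x ∉ Ioo a b, h x = 1 := fun x hx => by simp [hh, hx]
  have hhpos : ∀ x, 0 < h x := fun x => by
    by_cases hx : x ∈ Ioo a b
    · rw [hin x hx]; exact hpos x hx
    · rw [hout x hx]; exact one_pos
  have hI : ∀ c d, IntervalIntegrable h volume c d := fun c d => by
    refine (hint.integrable_indicator measurableSet_Ioo).intervalIntegrable.add ?_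
    have h1 : IntervalIntegrable (fun _ : ℝ => (1 : ℝ)) volume c d := intervalIntegrable_const
    rw [intervalIntegrable_iff] at h1 ⊢
    exact h1.indicator measurableSet_Ioo.compl
  have hmono : StrictMono fun x => ∫ y in a..x, h y := by
    intro c d hcd
    have := intervalIntegral.intervalIntegral_pos_of_pos (hI c d) hhpos hcd
    rw [← intervalIntegral.integral_interval_sub_left (hI a d) (hI a c)] at this
    exact sub_pos.1 this
  have hcontΘ : Continuous fun x => ∫ y in a..x, h y := intervalIntegral.continuous_primitive hI a
  have hright : ∀ x, b ≤ x → ∫ y in a..x, h y = (∫ y in a..b, h y) + (x - b) := by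
    intro x hx
    rw [← intervalIntegral.integral_add_adjacent_intervals (hI a b) (hI b x)]
    congr 1
    rw [intervalIntegral.integral_congr (g := fun _ => (1 : ℝ)) fun y hy => ?_]
    · simp
    · rw [uIcc_of_le hx] at hy
      exact hout y fun hy' => absurd hy'.2 (not_lt.2 hy.1)
  have hleft : ∀ x, x ≤ a → ∫ y in a..x, h y = x - a := by
    intro x hx
    rw [intervalIntegral.integral_congr (g := fun _ => (1 : ℝ)) fun y hy => ?_]
    · simp
    · rw [uIcc_of_ge hx] at hy
      exact hout y fun hy' => absurd hy'.1 (not_lt.2 hy.2)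
  have hsurj : Function.Surjective fun x => ∫ y in a..x, h y := by
    refine hcontΘ.surjective ?_ ?_
    · refine tendsto_atTop_mono' atTop (f₁ := fun x => (∫ y in a..b, h y) + (x - b)) ?_ ?_
      · filter_upwards [eventually_ge_atTop b] with x hx
        exact (hright x hx).ge
      · exact tendsto_atTop_add_const_left _ _ (tendsto_atTop_add_const_right _ _ tendsto_id)
    · refine tendsto_atBot_mono' atBot (f₁ := fun x => x - a) ?_ ?_
      · filter_upwards [eventually_le_atBot a] with x hx
        exact (hleft x hx).le
      · exact tendsto_atBot_add_const_right _ _ tendsto_id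
  refine ⟨hmono.orderIsoOfSurjective _ hsurj, ?_, ?_, fun x hx => ?_⟩
  · simp
  · simp only [StrictMono.coe_orderIsoOfSurjective]
    rw [intervalIntegral.integral_of_le hab.le, integral_Ioc_eq_integral_Ioo]
    exact setIntegral_congr_fun measurableSet_Ioo hin
  · simp only [StrictMono.coe_orderIsoOfSurjective]
    have hev : h =ᶠ[𝓝 x] h₀ := by
      filter_upwards [Ioo_mem_nhds hx.1 hx.2] with y hy using hin y hy
    have hc : ContinuousAt h x :=
      (hcont.continuousAt (Ioo_mem_nhds hx.1 hx.2)).congr hev.symm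
    rw [← hin x hx]
    refine intervalIntegral.integral_hasDerivAt_right (hI a x) ?_ hc
    exact ⟨univ, univ_mem, (locallyIntegrable_iff.2 fun K hK => by
      obtain ⟨R, hR⟩ := hK.isBounded.subset_closedBall 0
      rw [Real.closedBall_eq_Icc] at hR
      have := (hI (0 - R) (0 + R))
      rcases le_total (0 - R) (0 + R) with hRR | hRR
      · exact ((intervalIntegrable_iff_integrableOn_Icc_of_le hRR).1 this).mono_set hR
      · have h2 : volume K = 0 := measure_mono_null hR (by simp; linarith)
        rw [IntegrableOn, Measure.restrict_eq_zero.2 h2]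
        exact integrable_zero_measure).aestronglyMeasurable.restrict⟩

lemma continuousOn_slowness (hp : 2 < p) (hpq : p < q) (hE : E ∈ Ioo 0 (Estar p q)) :
    ContinuousOn (slowness p q E) (Ioo (leftRoot p q E) (rightRoot p q E)) := by
  rw [← well_eq hp hpq hE]
  intro x hx
  refine ContinuousAt.continuousWithinAt (ContinuousAt.rpow_const ?_
    (Or.inl (mul_pos (conjExponent_pos hp) (sub_pos.2 hx.2)).ne'))
  exact continuousAt_const.mul (continuousAt_const.sub
    (continuous_potential (by linarith) (by linarith)).continuousAt)

lemma leftRoot_lt_rightRoot (hp : 2 < p) (hpq : p < q) (hE : E ∈ Ioo 0 (Estar p q)) :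
    leftRoot p q E < rightRoot p q E :=
  (leftRoot_mem hp hpq hE).2.trans (one_lt_rightRoot hp hpq hE)

/-- `Θ` is the time needed to travel from the left turning point of the energy level `E`. -/
structure IsTimeMap (p q E : ℝ) (Θ : ℝ ≃o ℝ) : Prop where
  map_left : Θ (leftRoot p q E) = 0
  map_right : Θ (rightRoot p q E) = period p q E / 2
  hasDerivAt : ∀ x ∈ Ioo (leftRoot p q E) (rightRoot p q E), HasDerivAt Θ (slowness p q E x) x

lemma exists_isTimeMap (hp : 2 < p) (hpq : p < q) (hE : E ∈ Ioo 0 (Estar p q)) :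
    ∃ Θ : ℝ ≃o ℝ, IsTimeMap p q E Θ := by
  have hpos : ∀ x ∈ Ioo (leftRoot p q E) (rightRoot p q E), 0 < slowness p q E x := by
    rw [← well_eq hp hpq hE]
    exact fun x hx => slowness_pos hp hx.2
  obtain ⟨Θ, h1, h2, h3⟩ := exists_orderIso_primitive (leftRoot_lt_rightRoot hp hpq hE)
    (period_formula hp hpq hE).1 hpos (continuousOn_slowness hp hpq hE)
  refine ⟨Θ, h1, ?_, h3⟩
  rw [h2, period, well_eq hp hpq hE]
  ring

lemma period_pos (hp : 2 < p) (hpq : p < q) (hE : E ∈ Ioo 0 (Estar p q)) :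
    0 < period p q E := by
  obtain ⟨Θ, hΘ⟩ := exists_isTimeMap hp hpq hE
  have := Θ.strictMono (leftRoot_lt_rightRoot hp hpq hE)
  rw [hΘ.map_left, hΘ.map_right] at this
  linarith

/-! ### Solutions of a given energy -/

lemma IsSolution.hasDerivAt_phi (hw : IsSolution p q w) (t : ℝ) :
    HasDerivAt (fun s => phi p (deriv w s)) (-(phi q (w t) - phi p (w t))) t := by
  have h := (hw.2.1 t).hasDerivAt
  rwa [show deriv (fun s => phi p (deriv w s)) t = -(phi q (w t) - phi p (w t)) by
    linarith [hw.2.2 t]] at h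

lemma periodic_phi_deriv {S : ℝ} (hS : Function.Periodic w S) :
    Function.Periodic (fun s => phi p (deriv w s)) S := by
  intro t
  have : deriv w (t + S) = deriv w t := by
    rw [← deriv_comp_add_const]
    congr 1
    exact funext hS
  simp only [this]

/-- If w stayed above 1, φ_p(w') would be strictly decreasing as well as periodic. -/
lemma IsPositivePeriodicSolution.exists_le_one (hpq : p < q)
    (hw : IsPositivePeriodicSolution p q w) : ∃ t, w t ≤ 1 := by
  by_contra! h
  obtain ⟨hsol, -, S, hS, hper⟩ := hw
  have hanti : StrictAnti fun s => phi p (deriv w s) := strictAnti_of_deriv_neg fun t => by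
    rw [(hsol.hasDerivAt_phi t).deriv]
    exact neg_lt_zero.2 (phi_sub_phi_pos hpq (h t))
  have h1 := hanti (show 0 < 0 + S by linarith)
  exact h1.ne (periodic_phi_deriv hper 0)

lemma IsPositivePeriodicSolution.exists_one_le (hpq : p < q)
    (hw : IsPositivePeriodicSolution p q w) : ∃ t, 1 ≤ w t := by
  by_contra! h
  obtain ⟨hsol, hpos, S, hS, hper⟩ := hw
  have hmono : StrictMono fun s => phi p (deriv w s) := strictMono_of_deriv_pos fun t => by
    rw [(hsol.hasDerivAt_phi t).deriv]
    exact neg_pos.2 (phi_sub_phi_neg hpq (hpos t) (h t))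
  have h1 := hmono (show 0 < 0 + S by linarith)
  exact h1.ne' (periodic_phi_deriv hper 0)

lemma exists_forall_le_of_periodic {S : ℝ} (hS : 0 < S) (hper : Function.Periodic w S)
    (hc : Continuous w) : ∃ t, ∀ s, w t ≤ w s := by
  obtain ⟨t, -, ht⟩ := isCompact_Icc.exists_isMinOn (nonempty_Icc.2 hS.le) hc.continuousOn
  refine ⟨t, fun s => ?_⟩
  obtain ⟨r, hr, hrs⟩ := hper.exists_mem_Ico₀ hS s
  rw [hrs]
  exact ht ⟨hr.1, hr.2.le⟩

lemma exists_forall_ge_of_periodic {S : ℝ} (hS : 0 < S) (hper : Function.Periodic w S)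
    (hc : Continuous w) : ∃ t, ∀ s, w s ≤ w t := by
  obtain ⟨t, ht⟩ := exists_forall_le_of_periodic (w := fun s => -w s) hS
    (fun s => by simp [hper s]) hc.neg
  exact ⟨t, fun s => neg_le_neg_iff.1 (ht s)⟩

lemma HasEnergy.potential_le (hp : 2 < p) (hE : HasEnergy p q w E) (t : ℝ) :
    potential p q (w t) ≤ E := by
  have := conjExponent_pos hp
  rw [← hE t]
  have : 0 ≤ 1 / Real.conjExponent p * |deriv w t| ^ p := by positivity
  linarith

lemma HasEnergy.abs_deriv_rpow (hp : 2 < p) (hE : HasEnergy p q w E) (t : ℝ) :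
    |deriv w t| ^ p = Real.conjExponent p * (E - potential p q (w t)) := by
  have := conjExponent_pos hp
  rw [← hE t]
  field_simp
  ring

lemma HasEnergy.deriv_eq_zero_iff (hp : 2 < p) (hE : HasEnergy p q w E) (t : ℝ) :
    deriv w t = 0 ↔ potential p q (w t) = E := by
  have hc := conjExponent_pos hp
  have h := hE.abs_deriv_rpow hp t
  constructor
  · intro h0
    rw [h0, abs_zero, Real.zero_rpow (by linarith)] at h
    have := (mul_eq_zero.1 h.symm).resolve_left hc.ne'
    linarith
  · intro h0
    rw [h0, sub_self, mul_zero, Real.rpow_eq_zero (abs_nonneg _) (by linarith)] at h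
    exact abs_eq_zero.1 h

lemma HasEnergy.slowness_eq (hp : 2 < p) (hE : HasEnergy p q w E) (t : ℝ) :
    slowness p q E (w t) = |deriv w t|⁻¹ := by
  rw [slowness, ← hE.abs_deriv_rpow hp, ← Real.rpow_mul (abs_nonneg _),
    show p * -(1 / p) = -1 by field_simp, Real.rpow_neg_one]

lemma deriv_eq_zero_iff_turning
    (hp : 2 < p) (hpq : p < q) (hE : E ∈ Ioo 0 (Estar p q))
    (hw : IsPositivePeriodicSolution p q w) (hwE : HasEnergy p q w E)
    (t : ℝ) :
    deriv w t = 0 ↔ w t = leftRoot p q E ∨ w t = rightRoot p q E := by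
  rw [hwE.deriv_eq_zero_iff hp, potential_eq_iff hp hpq (leftRoot_mem hp hpq hE)
    (potential_leftRoot hp hpq hE) (one_lt_rightRoot hp hpq hE)
    (potential_rightRoot hp hpq hE) (hw.2.1 t)]

lemma mem_Ioo_of_ne_turning
    (hp : 2 < p) (hpq : p < q) (hE : E ∈ Ioo 0 (Estar p q))
    (hw : IsPositivePeriodicSolution p q w) (hwE : HasEnergy p q w E)
    {t : ℝ} (hl : w t ≠ leftRoot p q E) (hr : w t ≠ rightRoot p q E) :
    w t ∈ Ioo (leftRoot p q E) (rightRoot p q E) := by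
  refine (potential_lt_iff hp hpq (leftRoot_mem hp hpq hE)
    (potential_leftRoot hp hpq hE) (one_lt_rightRoot hp hpq hE)
    (potential_rightRoot hp hpq hE) (hw.2.1 t)).1 ((hwE.potential_le hp t).lt_of_ne fun h => ?_)
  rw [potential_eq_iff hp hpq (leftRoot_mem hp hpq hE)
    (potential_leftRoot hp hpq hE) (one_lt_rightRoot hp hpq hE)
    (potential_rightRoot hp hpq hE) (hw.2.1 t)] at h
  exact h.elim hl hr

lemma exists_eq_leftRoot
    (hp : 2 < p) (hpq : p < q) (hE : E ∈ Ioo 0 (Estar p q))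
    (hw : IsPositivePeriodicSolution p q w) (hwE : HasEnergy p q w E) :
    ∃ t, w t = leftRoot p q E := by
  obtain ⟨S, hS, hper⟩ := hw.2.2
  obtain ⟨t, ht⟩ := exists_forall_le_of_periodic hS hper hw.1.1.continuous
  have hd : deriv w t = 0 := IsLocalMin.deriv_eq_zero (.of_forall ht)
  refine ⟨t, ((deriv_eq_zero_iff_turning hp hpq hE hw hwE t).1 hd).resolve_right fun h => ?_⟩
  obtain ⟨s, hs⟩ := hw.exists_le_one hpq
  have := one_lt_rightRoot hp hpq hE
  linarith [ht s]

lemma exists_eq_rightRoot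
    (hp : 2 < p) (hpq : p < q) (hE : E ∈ Ioo 0 (Estar p q))
    (hw : IsPositivePeriodicSolution p q w) (hwE : HasEnergy p q w E) :
    ∃ t, w t = rightRoot p q E := by
  obtain ⟨S, hS, hper⟩ := hw.2.2
  obtain ⟨t, ht⟩ := exists_forall_ge_of_periodic hS hper hw.1.1.continuous
  have hd : deriv w t = 0 := IsLocalMax.deriv_eq_zero (.of_forall ht)
  refine ⟨t, ((deriv_eq_zero_iff_turning hp hpq hE hw hwE t).1 hd).resolve_left fun h => ?_⟩
  obtain ⟨s, hs⟩ := hw.exists_one_le hpq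
  have := (leftRoot_mem hp hpq hE).2
  linarith [ht s]

/-- The energy identity alone would let a solution rest at a turning point. The second-order
equation forbids it: a solution constant on an interval has V' = 0 there. -/
lemma exists_ne_of_lt (hpq : p < q) (hw : IsPositivePeriodicSolution p q w)
    {m c d : ℝ} (hm : m ≠ 1) (hcd : c < d) : ∃ t ∈ Ioo c d, w t ≠ m := by
  by_contra! h
  obtain ⟨t, ht⟩ := nonempty_Ioo.2 hcd
  have hev : w =ᶠ[𝓝 t] fun _ => m := by
    filter_upwards [Ioo_mem_nhds ht.1 ht.2] with s hs using h s hs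
  have hev' : (fun s => phi p (deriv w s)) =ᶠ[𝓝 t] fun _ => 0 := by
    filter_upwards [hev.eventuallyEq_nhds] with s hs
    rw [hs.deriv_eq, deriv_const]
    simp [phi]
  have h0 := (hw.1.hasDerivAt_phi t).unique
    ((hasDerivAt_const t (0 : ℝ)).congr_of_eventuallyEq hev')
  rw [h t ht, neg_eq_zero] at h0
  exact phi_sub_phi_ne_zero hpq (h t ht ▸ hw.2.1 t) hm h0

lemma exists_next_turning
    (hp : 2 < p) (hpq : p < q) (hE : E ∈ Ioo 0 (Estar p q))
    (hw : IsPositivePeriodicSolution p q w) (hwE : HasEnergy p q w E)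
    {m M s : ℝ} (hmM : m = leftRoot p q E ∧ M = rightRoot p q E ∨
      m = rightRoot p q E ∧ M = leftRoot p q E) (hs : w s = m) :
    ∃ t, s < t ∧ w t = M ∧ ∀ r ∈ Ioo s t, w r ∈ Ioo (leftRoot p q E) (rightRoot p q E) := by
  have hlt := leftRoot_lt_rightRoot hp hpq hE
  have hm1 : m ≠ 1 := by
    rcases hmM with h | h
    · rw [h.1]; exact (leftRoot_mem hp hpq hE).2.ne
    · rw [h.1]; exact (one_lt_rightRoot hp hpq hE).ne'
  have hne : m ≠ M := by
    rcases hmM with h | h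
    · rw [h.1, h.2]; exact hlt.ne
    · rw [h.1, h.2]; exact hlt.ne'
  have hcrit : ∀ t, deriv w t = 0 → w t = m ∨ w t = M := fun t ht => by
    have := (deriv_eq_zero_iff_turning hp hpq hE hw hwE t).1 ht
    rcases hmM with h | h <;> rw [h.1, h.2] <;> tauto
  have hex : ∃ t, s < t ∧ w t = M := by
    have h0 : ∃ t, w t = M := by
      rcases hmM with h | h <;> rw [h.2]
      · exact exists_eq_rightRoot hp hpq hE hw hwE
      · exact exists_eq_leftRoot hp hpq hE hw hwE
    obtain ⟨t, ht⟩ := h0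
    obtain ⟨S, hS, hper⟩ := hw.2.2
    obtain ⟨r, hr, hrt⟩ := hper.exists_mem_Ico hS t (s + S)
    exact ⟨r, by linarith [hr.1], by rw [← hrt, ht]⟩
  obtain ⟨t', hst', ht'⟩ := hex
  have hc := hw.1.1.continuous
  have hcomp : IsCompact (Icc s t' ∩ w ⁻¹' {M}) :=
    isCompact_Icc.inter_right (isClosed_singleton.preimage hc)
  -- The first time after s at which the opposite turning value M is reached.
  obtain ⟨t, ⟨htI, htM⟩, htle⟩ := hcomp.exists_isLeast ⟨t', ⟨hst'.le, le_rfl⟩, ht'⟩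
  have htM : w t = M := htM
  have hst : s < t := lt_of_le_of_ne htI.1 fun h => hne (by rw [← hs, h, htM])
  have hnM : ∀ r ∈ Ico s t, w r ≠ M := fun r hr hrM =>
    absurd (htle ⟨⟨hr.1, hr.2.le.trans htI.2⟩, hrM⟩) (not_le.2 hr.2)
  have hnm : ∀ r ∈ Ioo s t, w r ≠ m := by
    intro r hr hrm
    obtain ⟨r', hr', hr'm⟩ := exists_ne_of_lt hpq hw hm1 hr.1
    -- A return to m before t would give (w - m)² an interior positive maximum, a critical point
    -- with value neither m nor M. The square treats m as minimum and as maximum alike.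
    have hcu : Continuous fun y => (w y - m) ^ 2 := by fun_prop
    obtain ⟨c, hcI, hcmax⟩ := isCompact_Icc.exists_isMaxOn (nonempty_Icc.2 hr.1.le)
      hcu.continuousOn
    have hcm : 0 < (w c - m) ^ 2 :=
      (sq_pos_of_ne_zero (sub_ne_zero.2 hr'm)).trans_le (hcmax ⟨hr'.1.le, hr'.2.le⟩)
    have hcm' : w c ≠ m := fun h => by simp [h] at hcm
    have hcs : s < c := lt_of_le_of_ne hcI.1 fun h => hcm' (h ▸ hs)
    have hcr : c < r := lt_of_le_of_ne hcI.2 fun h => hcm' (h ▸ hrm)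
    have hmax := hcmax.isLocalMax (Icc_mem_nhds hcs hcr)
    have hd0 := hmax.hasDerivAt_eq_zero (((hw.1.1 c).hasDerivAt.sub_const m).pow 2)
    have hd : deriv w c = 0 := by
      have : w c - m ≠ 0 := sub_ne_zero.2 hcm'
      simpa [this] using hd0
    exact (hcrit c hd).elim hcm' (hnM c ⟨hcI.1, hcr.trans hr.2⟩)
  refine ⟨t, hst, htM, fun r hr => ?_⟩
  have h1 := hnm r hr
  have h2 := hnM r ⟨hr.1.le, hr.2⟩
  apply mem_Ioo_of_ne_turning hp hpq hE hw hwE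
  · rcases hmM with h | h
    · rwa [← h.1]
    · rwa [← h.2]
  · rcases hmM with h | h
    · rwa [← h.2]
    · rwa [← h.1]

/-- By the chain rule (Θ ∘ w)' = w'/|w'|; w' has no zero between turning points, so by Darboux this
is a constant sign. -/
lemma timeMap_comp_affine
    (hp : 2 < p) (hpq : p < q) (hE : E ∈ Ioo 0 (Estar p q))
    (hw : IsPositivePeriodicSolution p q w) (hwE : HasEnergy p q w E)
    {Θ : ℝ ≃o ℝ} (hΘ : IsTimeMap p q E Θ) {s t : ℝ}
    (h : ∀ r ∈ Ioo s t, w r ∈ Ioo (leftRoot p q E) (rightRoot p q E)) :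
    ∃ σ : ℝ, (σ = 1 ∨ σ = -1) ∧ ∀ r ∈ Icc s t, Θ (w r) = Θ (w s) + σ * (r - s) := by
  have hne : ∀ r ∈ Ioo s t, deriv w r ≠ 0 := fun r hr h0 =>
    ((deriv_eq_zero_iff_turning hp hpq hE hw hwE r).1 h0).elim (h r hr).1.ne' (h r hr).2.ne
  have hder : ∀ r ∈ Ioo s t, HasDerivAt (fun r => Θ (w r)) (|deriv w r|⁻¹ * deriv w r) r :=
    fun r hr => by
      have := (hΘ.hasDerivAt _ (h r hr)).comp r (hw.1.1 r).hasDerivAt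
      rwa [hwE.slowness_eq hp] at this
  have hσ : ∃ σ : ℝ, (σ = 1 ∨ σ = -1) ∧ ∀ r ∈ Ioo s t, |deriv w r|⁻¹ * deriv w r = σ := by
    rcases hasDerivWithinAt_forall_lt_or_forall_gt_of_forall_ne (convex_Ioo s t)
      (fun r _ => (hw.1.1 r).hasDerivAt.hasDerivWithinAt) hne with hneg | hpos
    · refine ⟨-1, Or.inr rfl, fun r hr => ?_⟩
      have := hneg r hr
      rw [abs_of_neg this, inv_neg, neg_mul, inv_mul_cancel₀ this.ne]
    · refine ⟨1, Or.inl rfl, fun r hr => ?_⟩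
      have := hpos r hr
      rw [abs_of_pos this, inv_mul_cancel₀ this.ne']
  obtain ⟨σ, hσ1, hσ2⟩ := hσ
  refine ⟨σ, hσ1, fun r hr => ?_⟩
  rcases hr.1.eq_or_lt with rfl | hsr
  · simp
  have hcont : Continuous fun r => Θ (w r) := Θ.continuous.comp hw.1.1.continuous
  obtain ⟨c, hc, hslope⟩ := exists_hasDerivAt_eq_slope (fun r => Θ (w r)) _ hsr
    hcont.continuousOn fun y hy => hder y ⟨hy.1, hy.2.trans_le hr.2⟩
  rw [hσ2 c ⟨hc.1, hc.2.trans_le hr.2⟩, eq_div_iff (by linarith)] at hslope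
  linarith

lemma timeMap_after_min
    (hp : 2 < p) (hpq : p < q) (hE : E ∈ Ioo 0 (Estar p q))
    (hw : IsPositivePeriodicSolution p q w) (hwE : HasEnergy p q w E)
    {Θ : ℝ ≃o ℝ} (hΘ : IsTimeMap p q E Θ) {s : ℝ}
    (hs : w s = leftRoot p q E) {r : ℝ} (hr : r ∈ Icc 0 (period p q E)) :
    Θ (w (s + r)) = min r (period p q E - r) := by
  have hT := period_pos hp hpq hE
  obtain ⟨t, hst, ht, hin⟩ := exists_next_turning hp hpq hE hw hwE (Or.inl ⟨rfl, rfl⟩) hs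
  obtain ⟨u, htu, hu, hin'⟩ := exists_next_turning hp hpq hE hw hwE (Or.inr ⟨rfl, rfl⟩) ht
  obtain ⟨σ, hσ, h1⟩ := timeMap_comp_affine hp hpq hE hw hwE hΘ hin
  obtain ⟨σ', hσ', h2⟩ := timeMap_comp_affine hp hpq hE hw hwE hΘ hin'
  rw [hs, hΘ.map_left] at h1
  rw [ht, hΘ.map_right] at h2
  have h3 := h1 t ⟨hst.le, le_rfl⟩
  have h4 := h2 u ⟨htu.le, le_rfl⟩
  rw [ht, hΘ.map_right] at h3
  rw [hu, hΘ.map_left] at h4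
  -- The values 0 and T/2 of Θ at the ends fix the signs, and with them both durations as T/2.
  obtain rfl : σ = 1 := hσ.resolve_right fun h => by rw [h] at h3; linarith
  obtain rfl : σ' = -1 := hσ'.resolve_left fun h => by rw [h] at h4; linarith
  rcases le_total r (period p q E / 2) with h | h
  · rw [h1 (s + r) ⟨by linarith [hr.1], by linarith⟩, min_eq_left (by linarith)]
    ring
  · rw [h2 (s + r) ⟨by linarith, by linarith [hr.2]⟩, min_eq_right (by linarith)]
    linarith

lemma periodic_period
    (hp : 2 < p) (hpq : p < q) (hE : E ∈ Ioo 0 (Estar p q))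
    (hw : IsPositivePeriodicSolution p q w) (hwE : HasEnergy p q w E) :
    Function.Periodic w (period p q E) := by
  have hT := period_pos hp hpq hE
  obtain ⟨Θ, hΘ⟩ := exists_isTimeMap hp hpq hE
  obtain ⟨s, hs⟩ := exists_eq_leftRoot hp hpq hE hw hwE
  obtain ⟨S, hS, hper⟩ := hw.2.2
  have hstep : ∀ r, w r = leftRoot p q E → w (r + period p q E) = leftRoot p q E := fun r hr => by
    have := timeMap_after_min hp hpq hE hw hwE hΘ hr (r := period p q E) ⟨hT.le, le_rfl⟩
    rw [sub_self, min_eq_right hT.le, ← hΘ.map_left] at this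
    exact Θ.injective this
  have hn : ∀ n : ℕ, w (s + n * period p q E) = leftRoot p q E := fun n => by
    induction n with
    | zero => simpa using hs
    | succ n ih =>
      rw [show s + ((n + 1 : ℕ) : ℝ) * period p q E = s + n * period p q E + period p q E by
        push_cast; ring]
      exact hstep _ ih
  have hlarge : ∀ t, s ≤ t → w (t + period p q E) = w t := by
    intro t ht
    set n := ⌊(t - s) / period p q E⌋₊ with hndef
    have h1 : n ≤ (t - s) / period p q E := Nat.floor_le (div_nonneg (sub_nonneg.2 ht) hT.le)
    have h2 : (t - s) / period p q E < n + 1 := Nat.lt_floor_add_one _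
    rw [le_div_iff₀ hT] at h1
    rw [div_lt_iff₀ hT] at h2
    have hr : t - s - n * period p q E ∈ Icc 0 (period p q E) := ⟨by linarith, by linarith⟩
    have e1 := timeMap_after_min hp hpq hE hw hwE hΘ (hn n) hr
    have e2 := timeMap_after_min hp hpq hE hw hwE hΘ (hstep _ (hn n)) hr
    rw [← e1] at e2
    convert Θ.injective e2 using 2 <;> ring
  -- Times before s are carried past s by a multiple of the given period S.
  intro t
  obtain ⟨n, hn⟩ := exists_nat_ge ((s - t) / S)
  rw [div_le_iff₀ hS] at hn
  have h := hlarge (t + n * S) (by linarith)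
  rwa [show t + n * S + period p q E = t + period p q E + n * S by ring, hper.nat_mul n,
    hper.nat_mul n] at h

theorem isMinimalPeriod_period
    (hp : 2 < p) (hpq : p < q) (hE : E ∈ Ioo 0 (Estar p q))
    (hw : IsPositivePeriodicSolution p q w) (hwE : HasEnergy p q w E) :
    IsMinimalPeriod w (period p q E) := by
  have hT := period_pos hp hpq hE
  refine ⟨⟨hT, periodic_period hp hpq hE hw hwE⟩, fun S hS => ?_⟩
  obtain ⟨hS, hper⟩ := hS
  by_contra! h
  obtain ⟨Θ, hΘ⟩ := exists_isTimeMap hp hpq hE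
  obtain ⟨s, hs⟩ := exists_eq_leftRoot hp hpq hE hw hwE
  have h1 := timeMap_after_min hp hpq hE hw hwE hΘ hs (r := S) ⟨hS.le, h.le⟩
  rw [hper s, hs, hΘ.map_left] at h1
  -- A period S < T would bring w back to its minimum while Θ(w) is still positive.
  have : 0 < min S (period p q E - S) := lt_min hS (by linarith)
  linarith

/-! ### Existence of periodic solutions -/

/-- An isolated exceptional point is removable when the derivative extends continuously. It is used
at the turning times, for both X' and φ_p(X'). -/
lemma hasDerivAt_of_eventually_hasDerivAt_nhdsNE {f g : ℝ → ℝ} {x : ℝ}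
    (h : ∀ᶠ y in 𝓝[≠] x, HasDerivAt f (g y) y) (hf : ContinuousAt f x) (hg : ContinuousAt g x) :
    HasDerivAt f (g x) x := by
  rw [← nhdsLT_sup_nhdsGT, eventually_sup] at h
  have hr : HasDerivWithinAt f (g x) (Ici x) x := by
    refine hasDerivWithinAt_Ici_of_tendsto_deriv (s := {y | HasDerivAt f (g y) y})
      (fun y hy => hy.differentiableAt.differentiableWithinAt) hf.continuousWithinAt h.2 ?_
    refine (hg.tendsto.mono_left nhdsWithin_le_nhds).congr' ?_
    filter_upwards [h.2] with y hy using hy.deriv.symm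
  have hl : HasDerivWithinAt f (g x) (Iic x) x := by
    refine hasDerivWithinAt_Iic_of_tendsto_deriv (s := {y | HasDerivAt f (g y) y})
      (fun y hy => hy.differentiableAt.differentiableWithinAt) hf.continuousWithinAt h.1 ?_
    refine (hg.tendsto.mono_left nhdsWithin_le_nhds).congr' ?_
    filter_upwards [h.1] with y hy using hy.deriv.symm
  simpa using hl.union hr

/-- The triangular wave of period `2 τ`, equal to the identity on `[0, τ]`. -/
noncomputable def triangleWave (τ t : ℝ) : ℝ :=
  τ / Real.pi * Real.arccos (Real.cos (Real.pi / τ * t))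

/-- The slope of the triangular wave. -/
noncomputable def triangleSlope (τ t : ℝ) : ℝ :=
  Real.sin (Real.pi / τ * t) / |Real.sin (Real.pi / τ * t)|

lemma continuous_triangleWave (τ : ℝ) : Continuous (triangleWave τ) := by
  unfold triangleWave
  exact continuous_const.mul (Real.continuous_arccos.comp (by fun_prop))

lemma triangleWave_add_two_mul {τ : ℝ} (hτ : 0 < τ) (t : ℝ) :
    triangleWave τ (t + 2 * τ) = triangleWave τ t := by
  rw [triangleWave, triangleWave, show Real.pi / τ * (t + 2 * τ) = Real.pi / τ * t + 2 * Real.pi by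
    field_simp, Real.cos_add_two_pi]

lemma triangleWave_mem_Ioo {τ t : ℝ} (hτ : 0 < τ) (ht : Real.sin (Real.pi / τ * t) ≠ 0) :
    triangleWave τ t ∈ Ioo 0 τ := by
  have hπ := Real.pi_pos
  have hsq := Real.sin_sq_add_cos_sq (Real.pi / τ * t)
  have hs : 0 < Real.sin (Real.pi / τ * t) ^ 2 := by positivity
  have h1 : 0 < Real.arccos (Real.cos (Real.pi / τ * t)) := Real.arccos_pos.2 (by nlinarith)
  have h2 : Real.arccos (Real.cos (Real.pi / τ * t)) < Real.pi := by
    refine (Real.arccos_le_pi _).lt_of_ne fun h => ?_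
    rw [Real.arccos_eq_pi] at h
    nlinarith
  refine ⟨by unfold triangleWave; positivity, ?_⟩
  rw [triangleWave, div_mul_eq_mul_div, div_lt_iff₀ hπ]
  exact mul_lt_mul_of_pos_left h2 hτ

lemma triangleWave_of_sin_eq_zero {τ t : ℝ} (ht : Real.sin (Real.pi / τ * t) = 0) :
    triangleWave τ t = 0 ∨ triangleWave τ t = τ := by
  have hπ := Real.pi_pos
  rw [triangleWave]
  rcases Real.sin_eq_zero_iff_cos_eq.1 ht with h | h <;> rw [h]
  · left; simp
  · right; rw [Real.arccos_neg_one]; field_simp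

lemma hasDerivAt_triangleWave {τ t : ℝ} (hτ : 0 < τ) (ht : Real.sin (Real.pi / τ * t) ≠ 0) :
    HasDerivAt (triangleWave τ) (triangleSlope τ t) t := by
  have hπ := Real.pi_pos
  have hsq := Real.sin_sq_add_cos_sq (Real.pi / τ * t)
  have hs : 0 < Real.sin (Real.pi / τ * t) ^ 2 := by positivity
  have h1 : Real.cos (Real.pi / τ * t) ≠ -1 := fun h => by rw [h] at hsq; nlinarith
  have h2 : Real.cos (Real.pi / τ * t) ≠ 1 := fun h => by rw [h] at hsq; nlinarith
  have h := ((Real.hasDerivAt_arccos h1 h2).comp t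
    (((hasDerivAt_id t).const_mul (Real.pi / τ)).cos)).const_mul (τ / Real.pi)
  refine h.congr_deriv ?_
  have habs := abs_pos.2 ht
  rw [id, ← Real.sin_sq, Real.sqrt_sq_eq_abs, triangleSlope]
  field_simp

lemma triangleSlope_eventually_eq {τ t : ℝ} (ht : Real.sin (Real.pi / τ * t) ≠ 0) :
    ∃ σ : ℝ, (σ = 1 ∨ σ = -1) ∧ ∀ᶠ s in 𝓝 t, triangleSlope τ s = σ := by
  have hc : ContinuousAt (fun s => Real.sin (Real.pi / τ * s)) t := by fun_prop
  rcases lt_or_gt_of_ne ht with h | h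
  · refine ⟨-1, Or.inr rfl, ?_⟩
    filter_upwards [hc.eventually (gt_mem_nhds h)] with s hs
    rw [triangleSlope, abs_of_neg hs, div_neg, div_self hs.ne]
  · refine ⟨1, Or.inl rfl, ?_⟩
    filter_upwards [hc.eventually (lt_mem_nhds h)] with s hs
    rw [triangleSlope, abs_of_pos hs, div_self hs.ne']

lemma abs_triangleSlope_le_one (τ t : ℝ) : |triangleSlope τ t| ≤ 1 := by
  -- At zeros of the sine the quotient is 0/0 = 0, so only an inequality holds.
  rw [triangleSlope, abs_div, abs_abs]
  exact div_self_le_one _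

lemma eventually_sin_ne_zero {τ : ℝ} (hτ : 0 < τ) (t : ℝ) :
    ∀ᶠ s in 𝓝[≠] t, Real.sin (Real.pi / τ * s) ≠ 0 := by
  by_cases h : Real.sin (Real.pi / τ * t) = 0
  · have hd := ((hasDerivAt_id t).const_mul (Real.pi / τ)).sin
    refine hd.eventually_ne (mul_ne_zero (fun hc => ?_) ?_)
    · rcases Real.sin_eq_zero_iff_cos_eq.1 h with h' | h' <;> simp [h'] at hc
    · have := Real.pi_pos
      positivity
  · have hc : ContinuousAt (fun s => Real.sin (Real.pi / τ * s)) t := by fun_prop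
    exact (hc.eventually_ne h).filter_mono nhdsWithin_le_nhds

/-- The speed `|w'|` at position `x` on the energy level `E`. -/
noncomputable def speed (p q E x : ℝ) : ℝ :=
  (Real.conjExponent p * (E - potential p q x)) ^ (1 / p)

lemma continuous_speed (hp : 2 < p) (hpq : p < q) : Continuous (speed p q E) :=
  (continuous_const.mul (continuous_const.sub
    (continuous_potential (by linarith) (by linarith)))).rpow_const
    fun _ => Or.inr (one_div_nonneg.2 (by linarith))

lemma inv_slowness (hp : 2 < p) {x : ℝ} (hx : potential p q x ≤ E) :
    (slowness p q E x)⁻¹ = speed p q E x := by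
  rw [slowness, Real.rpow_neg (mul_nonneg (conjExponent_pos hp).le (sub_nonneg.2 hx)), inv_inv,
    speed]

lemma speed_rpow (hp : 2 < p) {x : ℝ} (hx : potential p q x ≤ E) :
    speed p q E x ^ p = Real.conjExponent p * (E - potential p q x) := by
  rw [speed, ← Real.rpow_mul (mul_nonneg (conjExponent_pos hp).le (sub_nonneg.2 hx)),
    one_div_mul_cancel (by linarith), Real.rpow_one]

lemma speed_nonneg (hp : 2 < p) {x : ℝ} (hx : potential p q x ≤ E) : 0 ≤ speed p q E x :=
  Real.rpow_nonneg (mul_nonneg (conjExponent_pos hp).le (sub_nonneg.2 hx)) _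

lemma speed_eq_zero (hp : 2 < p) {x : ℝ} (hx : potential p q x = E) : speed p q E x = 0 := by
  rw [speed, hx, sub_self, mul_zero, Real.zero_rpow (one_div_ne_zero (by linarith))]

lemma continuous_phi {r : ℝ} (hr : 2 ≤ r) : Continuous (phi r) :=
  (continuous_abs.rpow_const fun _ => Or.inr (by linarith)).mul continuous_id

lemma phi_mul_sign {r σ v : ℝ} (hσ : σ = 1 ∨ σ = -1) : phi r (v * σ) = phi r v * σ := by
  rcases hσ with rfl | rfl <;> simp [phi]

theorem exists_solution (hp : 2 < p) (hpq : p < q) (hE : E ∈ Ioo 0 (Estar p q)) :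
    ∃ w, IsPositivePeriodicSolution p q w ∧ HasEnergy p q w E := by
  obtain ⟨Θ, hΘ⟩ := exists_isTimeMap hp hpq hE
  set τ := period p q E / 2 with hτdef
  have hτ : 0 < τ := half_pos (period_pos hp hpq hE)
  set a := leftRoot p q E
  set b := rightRoot p q E
  have ha := leftRoot_mem hp hpq hE
  have hab := leftRoot_lt_rightRoot hp hpq hE
  set X : ℝ → ℝ := fun t => Θ.symm (triangleWave τ t) with hX
  set g : ℝ → ℝ := fun t => speed p q E (X t) * triangleSlope τ t with hg
  have hXc : Continuous X := Θ.symm.continuous.comp (continuous_triangleWave τ)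
  have hXIoo : ∀ t, Real.sin (Real.pi / τ * t) ≠ 0 → X t ∈ Ioo a b := fun t ht => by
    have h := triangleWave_mem_Ioo hτ ht
    constructor
    · rw [hX, ← Θ.lt_iff_lt, hΘ.map_left, Θ.apply_symm_apply]
      exact h.1
    · rw [hX, ← Θ.lt_iff_lt, hΘ.map_right, Θ.apply_symm_apply]
      exact h.2
  have hXend : ∀ t, Real.sin (Real.pi / τ * t) = 0 → X t = a ∨ X t = b := fun t ht => by
    rcases triangleWave_of_sin_eq_zero ht with h | h
    · left; simp only [hX]; rw [h, ← hΘ.map_left, Θ.symm_apply_apply]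
    · right; simp only [hX]; rw [h, hτdef, ← hΘ.map_right, Θ.symm_apply_apply]
  have hXpos : ∀ t, 0 < X t := fun t => by
    by_cases ht : Real.sin (Real.pi / τ * t) = 0
    · rcases hXend t ht with h | h <;> rw [h]
      · exact ha.1
      · exact ha.1.trans hab
    · exact ha.1.trans (hXIoo t ht).1
  have hVlt : ∀ t, Real.sin (Real.pi / τ * t) ≠ 0 → potential p q (X t) < E := fun t ht => by
    have := hXIoo t ht
    rw [← well_eq hp hpq hE] at this
    exact this.2
  have hVend : ∀ t, Real.sin (Real.pi / τ * t) = 0 → potential p q (X t) = E := fun t ht => by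
    rcases hXend t ht with h | h <;> rw [h]
    · exact potential_leftRoot hp hpq hE
    · exact potential_rightRoot hp hpq hE
  have hVle : ∀ t, potential p q (X t) ≤ E := fun t => by
    by_cases ht : Real.sin (Real.pi / τ * t) = 0
    · exact (hVend t ht).le
    · exact (hVlt t ht).le
  -- The slope jumps at turning times, but the speed vanishes there and absorbs the jump.
  have hgc : Continuous g := continuous_iff_continuousAt.2 fun t => by
    have hsc : ContinuousAt (fun s => speed p q E (X s)) t :=
      ((continuous_speed hp hpq).comp hXc).continuousAt
    by_cases ht : Real.sin (Real.pi / τ * t) = 0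
    · have h0 : speed p q E (X t) = 0 := speed_eq_zero hp (hVend t ht)
      have hg0 : g t = 0 := by simp [hg, h0]
      rw [ContinuousAt, h0] at hsc
      rw [ContinuousAt, hg0]
      refine squeeze_zero_norm (fun s => ?_) hsc
      rw [Real.norm_eq_abs, abs_mul, abs_of_nonneg (speed_nonneg hp (hVle s))]
      exact mul_le_of_le_one_right (speed_nonneg hp (hVle s)) (abs_triangleSlope_le_one τ s)
    · obtain ⟨σ, -, hσ⟩ := triangleSlope_eventually_eq ht
      exact hsc.mul (continuousAt_const.congr (hσ.mono fun s hs => hs.symm))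
  have hXgood : ∀ t, Real.sin (Real.pi / τ * t) ≠ 0 → HasDerivAt X (g t) t := fun t ht => by
    have hΨ : HasDerivAt Θ.symm (slowness p q E (X t))⁻¹ (triangleWave τ t) :=
      HasDerivAt.of_local_left_inverse Θ.symm.continuous.continuousAt
        (hΘ.hasDerivAt _ (hXIoo t ht)) (slowness_pos hp (hVlt t ht)).ne'
        (.of_forall Θ.apply_symm_apply)
    rw [inv_slowness hp (hVle t)] at hΨ
    exact hΨ.comp t (hasDerivAt_triangleWave hτ ht)
  have hXd : ∀ t, HasDerivAt X (g t) t := fun t =>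
    hasDerivAt_of_eventually_hasDerivAt_nhdsNE
      ((eventually_sin_ne_zero hτ t).mono fun s hs => hXgood s hs) hXc.continuousAt
      hgc.continuousAt
  have hderiv : deriv X = g := funext fun t => (hXd t).deriv
  have hDgood : ∀ t, Real.sin (Real.pi / τ * t) ≠ 0 →
      HasDerivAt (fun s => phi p (g s)) (-(phi q (X t) - phi p (X t))) t := fun t ht => by
    obtain ⟨σ, hσ1, hσ⟩ := triangleSlope_eventually_eq ht
    have hc := conjExponent_pos hp
    have hp0 : 0 < p := by linarith
    have hbase : 0 < Real.conjExponent p * (E - potential p q (X t)) :=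
      mul_pos hc (sub_pos.2 (hVlt t ht))
    have hV := ((hasDerivAt_potential (p := p) (q := q) (by linarith) (by linarith)
      (X t)).comp t (hXd t))
    -- With σ locally constant, φ_p(X') = (p'(E - V(X)))^((p-1)/p) σ.
    have h := (((hV.const_sub E).const_mul (Real.conjExponent p)).rpow_const
      (p := (p - 1) / p) (Or.inl hbase.ne')).mul_const σ
    have hev : (fun s => phi p (g s)) =ᶠ[𝓝 t] fun s =>
        (Real.conjExponent p * (E - (potential p q ∘ X) s)) ^ ((p - 1) / p) * σ := by
      have hsin : ∀ᶠ s in 𝓝 t, Real.sin (Real.pi / τ * s) ≠ 0 :=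
        ContinuousAt.eventually_ne (by fun_prop) ht
      filter_upwards [hσ, hsin] with s hs hs'
      have hb : 0 < Real.conjExponent p * (E - potential p q (X s)) :=
        mul_pos hc (sub_pos.2 (hVlt s hs'))
      simp only [hg]
      rw [hs, phi_mul_sign hσ1, speed, phi_of_pos _ (Real.rpow_pos_of_pos hb _),
        ← Real.rpow_mul hb.le]
      congr 2
      field_simp
    refine (h.congr_of_eventuallyEq hev).congr_deriv ?_
    have hσσ : σ * σ = 1 := by rcases hσ1 with rfl | rfl <;> norm_num
    have hgt : g t = speed p q E (X t) * σ := by simp only [hg]; rw [hσ.self_of_nhds]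
    have hexp : (p - 1) / p - 1 = -(1 / p) := by field_simp; ring
    have hcoef : Real.conjExponent p * ((p - 1) / p) = 1 := by
      rw [Real.conjExponent]
      have : p - 1 ≠ 0 := by linarith
      field_simp
    simp only [Function.comp_apply]
    rw [hgt, hexp, Real.rpow_neg hbase.le]
    have hs0 : 0 < speed p q E (X t) := Real.rpow_pos_of_pos hbase _
    change _ * -((phi q (X t) - phi p (X t)) * (speed p q E (X t) * σ)) * _ *
      (speed p q E (X t))⁻¹ * σ = _
    calc _ = -(phi q (X t) - phi p (X t)) * (Real.conjExponent p * ((p - 1) / p)) * (σ * σ) *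
          (speed p q E (X t) * (speed p q E (X t))⁻¹) := by ring
      _ = _ := by rw [hcoef, hσσ, mul_inv_cancel₀ hs0.ne']; ring
  have hDd : ∀ t, HasDerivAt (fun s => phi p (g s)) (-(phi q (X t) - phi p (X t))) t := fun t =>
    hasDerivAt_of_eventually_hasDerivAt_nhdsNE (g := fun t => -(phi q (X t) - phi p (X t)))
      ((eventually_sin_ne_zero hτ t).mono fun s hs => hDgood s hs)
      ((continuous_phi hp.le).comp hgc).continuousAt
      (((continuous_phi (hp.trans hpq).le).comp hXc).sub
        ((continuous_phi hp.le).comp hXc)).neg.continuousAt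
  refine ⟨X, ⟨⟨fun t => (hXd t).differentiableAt, ?_, fun t => ?_⟩, hXpos, 2 * τ, by positivity,
    fun t => ?_⟩, fun t => ?_⟩
  · rw [hderiv]
    exact fun t => (hDd t).differentiableAt
  · rw [hderiv, (hDd t).deriv]
    ring
  · simp only [hX]
    rw [triangleWave_add_two_mul hτ]
  · have hc := conjExponent_pos hp
    rw [hderiv]
    by_cases ht : Real.sin (Real.pi / τ * t) = 0
    · have h0 : g t = 0 := by simp [hg, speed_eq_zero hp (hVend t ht)]
      rw [h0, abs_zero, Real.zero_rpow (by linarith), mul_zero, zero_add, hVend t ht]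
    · obtain ⟨σ, hσ1, hσ⟩ := triangleSlope_eventually_eq ht
      have habs : |g t| = speed p q E (X t) := by
        simp only [hg]
        rw [hσ.self_of_nhds, abs_mul, abs_of_nonneg (speed_nonneg hp (hVle t))]
        rcases hσ1 with rfl | rfl <;> simp
      rw [habs, speed_rpow hp (hVle t)]
      field_simp
      ring

/-! ### Conservation of energy -/

lemma abs_phi_rpow_conjExponent (hp : 2 < p) (v : ℝ) :
    |phi p v| ^ Real.conjExponent p = |v| ^ p := by
  have hp1 : p - 1 ≠ 0 := by linarith
  rcases eq_or_ne v 0 with rfl | hv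
  · simp [phi, Real.zero_rpow (conjExponent_pos hp).ne', Real.zero_rpow (show p ≠ 0 by linarith)]
  · have hv' := abs_pos.2 hv
    have h : |phi p v| = |v| ^ (p - 1) := by
      rw [← phi_of_pos p hv', phi, phi, abs_mul, abs_abs, abs_of_nonneg (Real.rpow_nonneg hv'.le _)]
    rw [h, ← Real.rpow_mul hv'.le, Real.conjExponent, mul_div_cancel₀ _ hp1]

lemma phi_conjExponent_phi (hp : 2 < p) (v : ℝ) : phi (Real.conjExponent p) (phi p v) = v := by
  have hp1 : p - 1 ≠ 0 := by linarith
  rcases eq_or_ne v 0 with rfl | hv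
  · simp [phi]
  · have hv' := abs_pos.2 hv
    have h : |phi p v| = |v| ^ (p - 1) := by
      rw [← phi_of_pos p hv', phi, phi, abs_mul, abs_abs, abs_of_nonneg (Real.rpow_nonneg hv'.le _)]
    rw [phi, h, phi, ← Real.rpow_mul hv'.le, ← mul_assoc, ← Real.rpow_add hv']
    rw [show (p - 1) * (Real.conjExponent p - 2) + (p - 2) = 0 by
      rw [Real.conjExponent]; field_simp; ring, Real.rpow_zero, one_mul]

/-- Only φ_p(w'), not w', is known to be differentiable, so the kinetic term is rewritten as
|φ_p(w')|^p'/p'. Its derivative is w' (φ_p(w'))', since φ_{p'} inverts φ_p. -/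
lemma IsSolution.exists_hasEnergy (hp : 2 < p) (hpq : p < q) (hw : IsSolution p q w) :
    ∃ E, HasEnergy p q w E := by
  have hc : 1 < Real.conjExponent p := by
    rw [Real.conjExponent, one_lt_div (by linarith)]; linarith
  have hder : ∀ t, HasDerivAt (fun t => 1 / Real.conjExponent p * |deriv w t| ^ p +
      potential p q (w t)) 0 t := fun t => by
    have h1 := (((hasDerivAt_abs_rpow (phi p (deriv w t)) hc).comp t
      (hw.hasDerivAt_phi t)).const_mul (1 / Real.conjExponent p)).add
      ((hasDerivAt_potential (p := p) (q := q) (by linarith) (by linarith) (w t)).comp t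
        (hw.1 t).hasDerivAt)
    have hfun : (fun t => 1 / Real.conjExponent p * |deriv w t| ^ p + potential p q (w t)) =
        (fun t => 1 / Real.conjExponent p * |phi p (deriv w t)| ^ Real.conjExponent p +
          potential p q (w t)) := by
      simp only [abs_phi_rpow_conjExponent hp]
    rw [hfun]
    refine h1.congr_deriv ?_
    have h2 := phi_conjExponent_phi hp (deriv w t)
    rw [phi] at h2
    rw [mul_assoc (Real.conjExponent p), h2]
    field_simp
    ring
  exact ⟨_, fun t => is_const_of_deriv_eq_zero (fun s => (hder s).differentiableAt)
    (fun s => (hder s).deriv) t 0⟩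

/-- At a minimum of w the energy equals V(min w), and the minimum lies in (0, 1]. -/
theorem IsPositivePeriodicSolution.exists_energy (hp : 2 < p) (hpq : p < q)
    (hw : IsPositivePeriodicSolution p q w) :
    ∃ E, 0 ≤ E ∧ E < Estar p q ∧ HasEnergy p q w E := by
  obtain ⟨E, hE⟩ := hw.1.exists_hasEnergy hp hpq
  obtain ⟨S, hS, hper⟩ := hw.2.2
  obtain ⟨t, ht⟩ := exists_forall_le_of_periodic hS hper hw.1.1.continuous
  obtain ⟨s, hs⟩ := hw.exists_le_one hpq
  have hV := (hE.deriv_eq_zero_iff hp t).1 (IsLocalMin.deriv_eq_zero (.of_forall ht))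
  refine ⟨E, ?_, ?_, hE⟩ <;> rw [← hV]
  · exact potential_nonneg hp hpq (hw.2.1 t)
  · exact potential_lt_Estar hp hpq (hw.2.1 t) ((ht s).trans hs)

end PLaplace

theorem theorem1p3 (p q : ℝ) (hp : 2 < p) (hpq : p < q) :
    (∀ w : ℝ → ℝ, PLaplace.IsPositivePeriodicSolution p q w →
      ∃ E, 0 ≤ E ∧ E < PLaplace.Estar p q ∧ PLaplace.HasEnergy p q w E) ∧
    ∃ T : ℝ → ℝ,
      (∀ E ∈ Set.Ioo 0 (PLaplace.Estar p q),
        (∃ w : ℝ → ℝ, PLaplace.IsPositivePeriodicSolution p q w ∧ PLaplace.HasEnergy p q w E) ∧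
        ∀ w : ℝ → ℝ, PLaplace.IsPositivePeriodicSolution p q w → PLaplace.HasEnergy p q w E →
          PLaplace.IsMinimalPeriod w (T E)) ∧
      StrictMonoOn T (Set.Ioo 0 (PLaplace.Estar p q)) ∧
      Filter.Tendsto T (nhdsWithin 0 (Set.Ioi 0)) (nhds 0) ∧
      Filter.Tendsto T (nhdsWithin (PLaplace.Estar p q) (Set.Iio (PLaplace.Estar p q)))
        Filter.atTop :=
  ⟨fun _ hw => hw.exists_energy hp hpq, PLaplace.period p q,
    fun _ hE => ⟨PLaplace.exists_solution hp hpq hE,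
      fun _ hw hwE => PLaplace.isMinimalPeriod_period hp hpq hE hw hwE⟩,
    PLaplace.period_strictMonoOn hp hpq, PLaplace.tendsto_period_zero hp hpq,
    PLaplace.tendsto_period_atTop hp hpq⟩
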